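/- Let $n\ge 3$, $m\ge 1$, let $\varepsilon_1,\dots,\varepsilon_n\in\{1,-1\}$, and let $g=\sum_{i}\varepsilon_i\,dx_i^2$ be the corresponding pseudo-Euclidean metric on $\mathbb{R}^n$ with coordinates $x=(x_1,\dots,x_n)$. Let $(F^m,g_F)$ be a non-empty semi-Riemannian manifold of dimension $m$ which is Einstein with constant Ricci curvature $\lambda_F\in\mathbb{R}$, i.e. $\mathrm{Ric}_{g_F}=\lambda_F\,g_F$ (so $\lambda_F=0$ if $m=1$). Let $f,\varphi,h:\mathbb{R}^n\to\mathbb{R}$ be smooth functions with $f>0$ everywhere and $\varphi\neq 0$ everywhere, put $\overline g=\varphi^{-2}g$, and let $M=(\mathbb{R}^n,\overline g)\times_f F^m$ be the warped product, that is, $\mathbb{R}^n\times F$ with the metric $\widetilde g=\overline g+f^2g_F$. Regard $h$ as a function on $M$ by $h(x,q)=h(x)$, and let $\rho\in\mathbb{R}$. Subscripts after a comma denote partial derivatives, $u_{,x_i}=\partial u/\partial x_i$ and $u_{,x_ix_j}=\partial^2u/\partial x_i\partial x_j$. Then $\widetilde g$ is a gradient Ricci soliton with potential function $h$ and constant $\rho$,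 i.e. $$\mathrm{Ric}_{\widetilde g}+\mathrm{Hess}_{\widetilde g}(h)=\rho\,\widetilde g ,$$ if and only if the following equations hold at every point of $\mathbb{R}^n$: for all $1\le i\ne j\le n$, $$(n-2)f\varphi_{,x_ix_j}+f\varphi h_{,x_ix_j}-m\varphi f_{,x_ix_j}-m\varphi_{,x_i}f_{,x_j}-m\varphi_{,x_j}f_{,x_i}+f\varphi_{,x_i}h_{,x_j}+f\varphi_{,x_j}h_{,x_i}=0;$$ for all $1\le i\le n$, $$\varphi\big[(n-2)f\varphi_{,x_ix_i}+f\varphi h_{,x_ix_i}-m\varphi f_{,x_ix_i}-2m\varphi_{,x_i}f_{,x_i}+2f\varphi_{,x_i}h_{,x_i}\big]+\varepsilon_i\sum_{k=1}^n\varepsilon_k\big[f\varphi\varphi_{,x_kx_k}-(n-1)f\varphi_{,x_k}^2+m\varphi\varphi_{,x_k}f_{,x_k}-f\varphi\varphi_{,x_k}h_{,x_k}\big]=\varepsilon_i\rho f;$$ and $$\sum_{k=1}^n\varepsilon_k\big[-f\varphi^2f_{,x_kx_k}+(n-2)f\varphi f_{,x_k}\varphi_{,x_k}-(m-1)\varphi^2f_{,x_k}^2+f\varphi^2f_{,x_k}h_{,x_k}\big]=\rho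 f^2-\lambda_F .$$ -/

import Mathlib

open scoped Manifold ContDiff

noncomputable section

set_option maxSynthPendingDepth 3

namespace SemiRiem

/-! ### Local formulas

A semi-Riemannian metric on an open subset of a finite dimensional vector space `E` is given by its
field of bilinear forms `G`. The formulas below are the usual ones, written without indices: the
constant vector fields on `E` play the role of coordinate vector fields. -/

section Local

variable {E : Type*} [NormedAddCommGroup E] [NormedSpace ℝ E]

/-- The Christoffel symbols of the first kind, as a trilinear form:
`(u, v, w) ↦ (1/2) (D_u G(v, w) + D_v G(u, w) - D_w G(u, v))`
(see `christoffelFirst_apply`). -/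
def christoffelFirst (G : E → E →L[ℝ] E →L[ℝ] ℝ) (y : E) : E →L[ℝ] E →L[ℝ] E →L[ℝ] ℝ :=
  (1 / 2 : ℝ) • (fderiv ℝ G y + (fderiv ℝ G y).flip
    - (ContinuousLinearMap.flipₗᵢ ℝ E E ℝ).toContinuousLinearEquiv.toContinuousLinearMap.comp
        (fderiv ℝ G y).flip)

theorem christoffelFirst_apply (G : E → E →L[ℝ] E →L[ℝ] ℝ) (y u v w : E) :
    christoffelFirst G y u v w =
      (1 / 2 : ℝ) * (fderiv ℝ G y u v w + fderiv ℝ G y v u w - fderiv ℝ G y w u v) := rfl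

/-- The Christoffel symbols of the second kind, as a vector valued bilinear map: `christoffel G y u v`
is the value at `y` of `∇_u v` for the constant vector fields `u`, `v` and the Levi-Civita connection
`∇` of `G`, that is, the vector with `G(∇_u v, w) = christoffelFirst G y u v w` for all `w`
(see `apply_christoffel`). The bilinear form `G y` is regarded as a map from `E` to its dual and
inverted. -/
def christoffel (G : E → E →L[ℝ] E →L[ℝ] ℝ) (y : E) : E →L[ℝ] E →L[ℝ] E :=
  (ContinuousLinearMap.compL ℝ E (E →L[ℝ] ℝ) E (G y).inverse).comp (christoffelFirst G y)

theorem christoffel_apply (G : E → E →L[ℝ] E →L[ℝ] ℝ) (y u v : E) :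
    christoffel G y u v = (G y).inverse (christoffelFirst G y u v) := rfl

/-- The defining property of the Christoffel symbols, wherever `G` is nondegenerate. -/
theorem apply_christoffel [FiniteDimensional ℝ E] (G : E → E →L[ℝ] E →L[ℝ] ℝ) (y : E)
    (hG : ∀ v, (∀ w, G y v w = 0) → v = 0) (u v w : E) :
    G y (christoffel G y u v) w = christoffelFirst G y u v w := by
  have hinj : Function.Injective (G y) := by
    rw [injective_iff_map_eq_zero]
    intro a ha
    exact hG a fun w => by rw [ha]; rfl
  have hdim : Module.finrank ℝ E = Module.finrank ℝ (E →L[ℝ] ℝ) := by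
    rw [← (LinearMap.toContinuousLinearMap (𝕜 := ℝ) (E := E) (F' := ℝ)).finrank_eq]
    exact (Subspace.dual_finrank_eq (K := ℝ) (V := E)).symm
  let e : E ≃L[ℝ] (E →L[ℝ] ℝ) :=
    (LinearEquiv.ofInjectiveOfFinrankEq (G y : E →ₗ[ℝ] (E →L[ℝ] ℝ)) hinj hdim).toContinuousLinearEquiv
  have he : G y = (e : E →L[ℝ] (E →L[ℝ] ℝ)) := by
    ext a b
    rfl
  rw [christoffel_apply, he, ContinuousLinearMap.inverse_equiv]
  simp

/-- The curvature endomorphism `u ↦ R(u, v) w = ∇_u ∇_v w - ∇_v ∇_u w` at `y`, for constant vector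
fields `u`, `v`, `w`:
`R(u, v) w = (D_u Γ)(v, w) - (D_v Γ)(u, w) + Γ(u, Γ(v, w)) - Γ(v, Γ(u, w))`. -/
def curvatureEnd (G : E → E →L[ℝ] E →L[ℝ] ℝ) (y v w : E) : E →ₗ[ℝ] E where
  toFun u := fderiv ℝ (christoffel G) y u v w - fderiv ℝ (christoffel G) y v u w
    + christoffel G y u (christoffel G y v w) - christoffel G y v (christoffel G y u w)
  map_add' a b := by
    simp only [map_add, add_apply]
    abel
  map_smul' c a := by
    simp only [map_smul, smul_apply, RingHom.id_apply, smul_sub, smul_add]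

/-- The Ricci tensor `Ric(v, w) = trace (u ↦ R(u, v) w)` at `y`. -/
def localRicci (G : E → E →L[ℝ] E →L[ℝ] ℝ) (y v w : E) : ℝ :=
  LinearMap.trace ℝ E (curvatureEnd G y v w)

/-- The Hessian `(∇ dk)(v, w) = D²k(v, w) - dk(∇_v w)` at `y`. -/
def localHessian (G : E → E →L[ℝ] E →L[ℝ] ℝ) (k : E → ℝ) (y v w : E) : ℝ :=
  fderiv ℝ (fderiv ℝ k) y v w - fderiv ℝ k y (christoffel G y v w)

end Local

/-- The bilinear form `∑ i, ε i * v i * w i` on `ℝⁿ` (see `pseudoEuclideanForm_apply`). -/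
def pseudoEuclideanForm {n : ℕ} (ε : Fin n → ℝ) :
    EuclideanSpace ℝ (Fin n) →L[ℝ] EuclideanSpace ℝ (Fin n) →L[ℝ] ℝ :=
  ∑ i, ε i • (EuclideanSpace.proj i).smulRight (EuclideanSpace.proj i)

theorem pseudoEuclideanForm_apply {n : ℕ} (ε : Fin n → ℝ) (v w : EuclideanSpace ℝ (Fin n)) :
    pseudoEuclideanForm ε v w = ∑ i, ε i * v i * w i := by
  simp [pseudoEuclideanForm, sum_apply, mul_assoc]

/-! ### Semi-Riemannian metrics on manifolds (without boundary) -/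

section Manifold

variable {E : Type*} [NormedAddCommGroup E] [NormedSpace ℝ E]
  {H : Type*} [TopologicalSpace H] {I : ModelWithCorners ℝ E H}
  {M : Type*} [TopologicalSpace M] [ChartedSpace H M]

/-- The pullback `(v, w) ↦ b (A v) (A w)` of a continuous bilinear form under a linear map. -/
def pullbackForm {V W : Type*} [AddCommGroup V] [Module ℝ V] [TopologicalSpace V]
    [IsTopologicalAddGroup V] [ContinuousSMul ℝ V] [AddCommGroup W] [Module ℝ W] [TopologicalSpace W]
    [IsTopologicalAddGroup W] [ContinuousSMul ℝ W]
    (b : W →L[ℝ] W →L[ℝ] ℝ) (A : V →L[ℝ] W) : V →L[ℝ] V →L[ℝ] ℝ :=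
  ((ContinuousLinearMap.precomp ℝ A : (W →L[ℝ] ℝ) →L[ℝ] (V →L[ℝ] ℝ)).comp b).comp A

theorem pullbackForm_apply {V W : Type*} [AddCommGroup V] [Module ℝ V] [TopologicalSpace V]
    [IsTopologicalAddGroup V] [ContinuousSMul ℝ V] [AddCommGroup W] [Module ℝ W] [TopologicalSpace W]
    [IsTopologicalAddGroup W] [ContinuousSMul ℝ W]
    (b : W →L[ℝ] W →L[ℝ] ℝ) (A : V →L[ℝ] W) (v w : V) :
    pullbackForm b A v w = b (A v) (A w) := rfl

theorem contDiffOn_pullbackForm {V W X : Type*} [NormedAddCommGroup V] [NormedSpace ℝ V]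
    [NormedAddCommGroup W] [NormedSpace ℝ W] [NormedAddCommGroup X] [NormedSpace ℝ X]
    {b : X → W →L[ℝ] W →L[ℝ] ℝ} {s : Set X} (hb : ContDiffOn ℝ ∞ b s) (A : V →L[ℝ] W) :
    ContDiffOn ℝ ∞ (fun x => pullbackForm (b x) A) s :=
  (contDiffOn_const.clm_comp hb).clm_comp contDiffOn_const

/-- The expression of a field of bilinear forms `g` in the chart around `p`: the pullback of `g` under
the inverse of the chart. -/
def chartForm (g : ∀ p : M, TangentSpace I p →L[ℝ] TangentSpace I p →L[ℝ] ℝ) (p : M) (y : E) :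
    E →L[ℝ] E →L[ℝ] ℝ :=
  pullbackForm (V := E) (g ((extChartAt I p).symm y))
    (mfderiv 𝓘(ℝ, E) I (extChartAt I p).symm y)

theorem chartForm_apply (g : ∀ p : M, TangentSpace I p →L[ℝ] TangentSpace I p →L[ℝ] ℝ) (p : M)
    (y v w : E) :
    chartForm g p y v w = g ((extChartAt I p).symm y)
      (mfderiv 𝓘(ℝ, E) I (extChartAt I p).symm y v)
      (mfderiv 𝓘(ℝ, E) I (extChartAt I p).symm y w) := rfl

theorem contDiffOn_comp_symm [IsManifold I ∞ M] {φ : M → ℝ} (hφ : ContMDiff I 𝓘(ℝ, ℝ) ∞ φ) (p : M) :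
    ContDiffOn ℝ ∞ (φ ∘ (extChartAt I p).symm) (extChartAt I p).target :=
  contMDiffOn_iff_contDiffOn.1 (hφ.comp_contMDiffOn (contMDiffOn_extChartAt_symm p))

variable (I M) in
/-- A smooth semi-Riemannian metric: a field of nondegenerate symmetric bilinear forms on the tangent
spaces whose expressions in the charts are smooth. -/
structure SemiRiemannianMetric [IsManifold I ∞ M] [I.Boundaryless] where
  /-- The bilinear form on each tangent space. -/
  val : ∀ p : M, TangentSpace I p →L[ℝ] TangentSpace I p →L[ℝ] ℝ
  symm : ∀ (p : M) (v w : TangentSpace I p), val p v w = val p w v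
  nondegenerate : ∀ (p : M) (v : TangentSpace I p), (∀ w, val p v w = 0) → v = 0
  smooth : ∀ p : M, ContDiffOn ℝ ∞ (chartForm val p) (extChartAt I p).target

namespace SemiRiemannianMetric

variable [IsManifold I ∞ M] [I.Boundaryless]

/-- The Ricci tensor of a semi-Riemannian metric, computed in the chart around the point. -/
def ricci (g : SemiRiemannianMetric I M) (p : M) (v w : TangentSpace I p) : ℝ :=
  localRicci (chartForm g.val p) (extChartAt I p p)
    (mfderiv I 𝓘(ℝ, E) (extChartAt I p) p v) (mfderiv I 𝓘(ℝ, E) (extChartAt I p) p w)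

/-- The Hessian of a function, computed in the chart around the point. -/
def hessian (g : SemiRiemannianMetric I M) (k : M → ℝ) (p : M) (v w : TangentSpace I p) : ℝ :=
  localHessian (chartForm g.val p) (k ∘ (extChartAt I p).symm) (extChartAt I p p)
    (mfderiv I 𝓘(ℝ, E) (extChartAt I p) p v) (mfderiv I 𝓘(ℝ, E) (extChartAt I p) p w)

/-- `g` is Einstein with constant Ricci curvature `lam`: `Ric = lam g`. -/
def IsEinstein (g : SemiRiemannianMetric I M) (lam : ℝ) : Prop :=
  ∀ (p : M) (v w : TangentSpace I p), g.ricci p v w = lam * g.val p v w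

/-- `(M, g)` is a gradient Ricci soliton with (smooth) potential function `k` and constant `ρ`:
`Ric + Hess k = ρ g`. -/
structure IsGradientRicciSoliton (g : SemiRiemannianMetric I M) (k : M → ℝ) (ρ : ℝ) : Prop where
  smooth_potential : ContMDiff I 𝓘(ℝ, ℝ) ∞ k
  equation : ∀ (p : M) (v w : TangentSpace I p),
    g.ricci p v w + g.hessian k p v w = ρ * g.val p v w

/-- The conformal metric `φ⁻² g`, for a smooth nowhere vanishing function `φ`. -/
def conformal (g : SemiRiemannianMetric I M) (φ : M → ℝ) (hφ : ContMDiff I 𝓘(ℝ, ℝ) ∞ φ)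
    (hφ0 : ∀ p, φ p ≠ 0) : SemiRiemannianMetric I M where
  val p := (φ p ^ 2)⁻¹ • g.val p
  symm p v w := by
    simp [g.symm p v w]
  nondegenerate p v hv := by
    refine g.nondegenerate p v fun w => ?_
    have := hv w
    simpa [hφ0 p] using this
  smooth p := by
    have h1 := ((contDiffOn_comp_symm hφ p).pow 2).inv fun y _ => pow_ne_zero 2 (hφ0 _)
    refine (h1.smul (g.smooth p)).congr fun y _ => ?_
    ext v w
    rfl

/-- The pseudo-Euclidean metric `∑ i, ε i * v i * w i` on `ℝⁿ`, where each `ε i` is `1` or `-1`. -/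
def pseudoEuclidean {n : ℕ} (ε : Fin n → ℝ) (hε : ∀ i, ε i = 1 ∨ ε i = -1) :
    SemiRiemannianMetric (𝓡 n) (EuclideanSpace ℝ (Fin n)) where
  val _ := pseudoEuclideanForm ε
  symm _ v w := by
    refine (pseudoEuclideanForm_apply ε v w).trans
      (Eq.trans ?_ (pseudoEuclideanForm_apply ε w v).symm)
    exact Finset.sum_congr rfl fun i _ => by ring
  nondegenerate _ v hv := by
    refine PiLp.ext fun i => ?_
    change (show EuclideanSpace ℝ (Fin n) from v) i = 0
    have h := (pseudoEuclideanForm_apply ε v (EuclideanSpace.single i 1)).symm.trans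
      (hv (EuclideanSpace.single i 1))
    have hi : ε i ≠ 0 := by rcases hε i with h | h <;> rw [h] <;> norm_num
    simpa [hi, Pi.single_apply] using h
  smooth p := by
    refine ContDiffOn.congr (f := fun _ => pseudoEuclideanForm ε) contDiffOn_const fun y _ => ?_
    have h : mfderiv (𝓡 n) (𝓡 n) (extChartAt (𝓡 n) p).symm y = ContinuousLinearMap.id ℝ _ := by
      simp only [mfld_simps]
      exact mfderiv_id
    unfold chartForm
    rw [h]
    rfl

end SemiRiemannianMetric

end Manifold

/-! ### Warped products -/

section Warped

variable {E : Type*} [NormedAddCommGroup E] [NormedSpace ℝ E]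
  {H : Type*} [TopologicalSpace H] {I : ModelWithCorners ℝ E H}
  {B : Type*} [TopologicalSpace B] [ChartedSpace H B] [IsManifold I ∞ B] [I.Boundaryless]
  {E' : Type*} [NormedAddCommGroup E'] [NormedSpace ℝ E']
  {H' : Type*} [TopologicalSpace H'] {J : ModelWithCorners ℝ E' H'}
  {F : Type*} [TopologicalSpace F] [ChartedSpace H' F] [IsManifold J ∞ F] [J.Boundaryless]

/-- The field of bilinear forms `π_B^* g_B + f² π_F^* g_F` on `B × F`, where `π_B` and `π_F` are the
projections. -/
def warpedForm (gB : SemiRiemannianMetric I B) (gF : SemiRiemannianMetric J F) (f : B → ℝ)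
    (p : B × F) :
    TangentSpace (I.prod J) p →L[ℝ] TangentSpace (I.prod J) p →L[ℝ] ℝ :=
  pullbackForm (gB.val p.1) (mfderiv (I.prod J) I Prod.fst p)
    + (f p.1 ^ 2) • pullbackForm (gF.val p.2) (mfderiv (I.prod J) J Prod.snd p)

theorem warpedForm_apply (gB : SemiRiemannianMetric I B) (gF : SemiRiemannianMetric J F) (f : B → ℝ)
    (p : B × F) (v w : TangentSpace (I.prod J) p) :
    warpedForm gB gF f p v w = gB.val p.1 v.1 w.1 + f p.1 ^ 2 * gF.val p.2 v.2 w.2 := by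
  have h1 : mfderiv (I.prod J) I Prod.fst p = ContinuousLinearMap.fst ℝ E E' := mfderiv_fst
  have h2 : mfderiv (I.prod J) J Prod.snd p = ContinuousLinearMap.snd ℝ E E' := mfderiv_snd
  rw [warpedForm, h1, h2]
  rfl

theorem chartForm_warpedForm (gB : SemiRiemannianMetric I B) (gF : SemiRiemannianMetric J F)
    (f : B → ℝ) (p : B × F) (y : E × E') (hy : y ∈ (extChartAt (I.prod J) p).target) :
    chartForm (warpedForm gB gF f) p y =
      pullbackForm (chartForm gB.val p.1 y.1) (ContinuousLinearMap.fst ℝ E E')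
        + (f ((extChartAt I p.1).symm y.1) ^ 2) •
          pullbackForm (chartForm gF.val p.2 y.2) (ContinuousLinearMap.snd ℝ E E') := by
  rw [extChartAt_prod] at hy
  have h1 : MDifferentiableAt 𝓘(ℝ, E) I (extChartAt I p.1).symm y.1 := by
    have := mdifferentiableWithinAt_extChartAt_symm (I := I) hy.1
    rwa [ModelWithCorners.Boundaryless.range_eq_univ, mdifferentiableWithinAt_univ] at this
  have h2 : MDifferentiableAt 𝓘(ℝ, E') J (extChartAt J p.2).symm y.2 := by
    have := mdifferentiableWithinAt_extChartAt_symm (I := J) hy.2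
    rwa [ModelWithCorners.Boundaryless.range_eq_univ, mdifferentiableWithinAt_univ] at this
  have h3 := mfderiv_prodMap h1 h2
  rw [← modelWithCornersSelf_prod, chartedSpaceSelf_prod] at h3
  have h4 : ((extChartAt (I.prod J) p).symm : E × E' → B × F)
      = Prod.map (extChartAt I p.1).symm (extChartAt J p.2).symm := by
    rw [extChartAt_prod]
    rfl
  have h5 : ((extChartAt (I.prod J) p).symm y) = ((extChartAt I p.1).symm y.1,
      (extChartAt J p.2).symm y.2) := by
    rw [h4]
    rfl
  have h6 : ∀ v : E × E', (mfderiv 𝓘(ℝ, E × E') (I.prod J) (extChartAt (I.prod J) p).symm y v : E × E')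
      = ((mfderiv 𝓘(ℝ, E) I (extChartAt I p.1).symm y.1 v.1 : E),
        (mfderiv 𝓘(ℝ, E') J (extChartAt J p.2).symm y.2 v.2 : E')) := by
    intro v
    rw [h4]
    exact congrArg (fun A : E × E' →L[ℝ] E × E' => A v) h3
  refine ContinuousLinearMap.ext fun v => ContinuousLinearMap.ext fun w => ?_
  rw [chartForm_apply]
  refine (warpedForm_apply gB gF f _ _ _).trans ?_
  have aux : ∀ (q : B × F) (a b : E × E') (a₁ b₁ : E) (a₂ b₂ : E'),
      q = ((extChartAt I p.1).symm y.1, (extChartAt J p.2).symm y.2) →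
      a = (a₁, a₂) → b = (b₁, b₂) →
      (gB.val q.1 : E →L[ℝ] E →L[ℝ] ℝ) a.1 b.1
        + f q.1 ^ 2 * (gF.val q.2 : E' →L[ℝ] E' →L[ℝ] ℝ) a.2 b.2
      = (gB.val ((extChartAt I p.1).symm y.1) : E →L[ℝ] E →L[ℝ] ℝ) a₁ b₁
        + f ((extChartAt I p.1).symm y.1) ^ 2 *
          (gF.val ((extChartAt J p.2).symm y.2) : E' →L[ℝ] E' →L[ℝ] ℝ) a₂ b₂ := by
    rintro _ _ _ a₁ b₁ a₂ b₂ rfl rfl rfl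
    rfl
  exact aux _ _ _ _ _ _ _ h5 (h6 v) (h6 w)

/-- The warped product `B ×_f F`: the manifold `B × F` with the metric `g_B + f² g_F`. -/
def warpedProduct (gB : SemiRiemannianMetric I B) (gF : SemiRiemannianMetric J F) (f : B → ℝ)
    (hf : ContMDiff I 𝓘(ℝ, ℝ) ∞ f) (hf0 : ∀ x, 0 < f x) :
    SemiRiemannianMetric (I.prod J) (B × F) where
  val := warpedForm gB gF f
  symm p v w := by
    refine (warpedForm_apply gB gF f p v w).trans
      (Eq.trans ?_ (warpedForm_apply gB gF f p w v).symm)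
    exact congrArg₂ (fun a b => a + f p.1 ^ 2 * b) (gB.symm p.1 _ _) (gF.symm p.2 _ _)
  nondegenerate p v hv := by
    refine Prod.ext (gB.nondegenerate p.1 _ fun w => ?_) (gF.nondegenerate p.2 _ fun w => ?_)
    · have h := (warpedForm_apply gB gF f p v (w, (0 : E'))).symm.trans (hv (w, (0 : E')))
      have h0 : gF.val p.2 v.2 (0 : E') = 0 := map_zero _
      have h' : gB.val p.1 v.1 w + f p.1 ^ 2 * gF.val p.2 v.2 (0 : E') = 0 := h
      rwa [h0, mul_zero, add_zero] at h'
    · have h := (warpedForm_apply gB gF f p v ((0 : E), w)).symm.trans (hv ((0 : E), w))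
      have h0 : gB.val p.1 v.1 (0 : E) = 0 := map_zero _
      have h' : gB.val p.1 v.1 (0 : E) + f p.1 ^ 2 * gF.val p.2 v.2 w = 0 := h
      rw [h0, zero_add] at h'
      exact (mul_eq_zero.1 h').resolve_left (pow_ne_zero 2 (hf0 p.1).ne')
  smooth p := by
    have hsub : (extChartAt (I.prod J) p).target
        ⊆ (extChartAt I p.1).target ×ˢ (extChartAt J p.2).target := by
      rw [extChartAt_prod]
      exact fun y hy => hy
    refine ContDiffOn.congr ?_ (fun y hy => chartForm_warpedForm gB gF f p y hy)
    have hB : Set.MapsTo Prod.fst (extChartAt (I.prod J) p).target (extChartAt I p.1).target :=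
      fun y hy => (hsub hy).1
    have hF : Set.MapsTo Prod.snd (extChartAt (I.prod J) p).target (extChartAt J p.2).target :=
      fun y hy => (hsub hy).2
    exact (contDiffOn_pullbackForm ((gB.smooth p.1).comp contDiffOn_fst hB) _).add
      ((((contDiffOn_comp_symm hf p.1).comp contDiffOn_fst hB).pow 2).smul
        (contDiffOn_pullbackForm ((gF.smooth p.2).comp contDiffOn_snd hF) _))

end Warped

/-- The partial derivative `∂u/∂x_i` of a function on `ℝⁿ`. -/
def partialDeriv {n : ℕ} (i : Fin n) (u : EuclideanSpace ℝ (Fin n) → ℝ) :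
    EuclideanSpace ℝ (Fin n) → ℝ :=
  fun x => fderiv ℝ u x (EuclideanSpace.single i 1)

end SemiRiem

end

open SemiRiem

/-!
The Ricci tensor and the Hessian at a point of a manifold are computed in the chart around that
point, so the soliton equation can be checked one point `(x, q)` at a time, in the product of `ℝⁿ`
with a chart of `F`. There the metric is `φ⁻² η + f² K`, with `η` the constant pseudo-Euclidean form
and `K` the expression of the metric of `F`, and the derivative of the chart at its base point is the
identity, so that the Einstein condition of `F` applies directly to `K`.

The local computation is free of coordinates and has two layers.

* For a warped product `G + f² K` of local metrics, the Levi-Civita connection is found by checking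
  its defining property (`christoffel_localWarped`). The trace defining the Ricci tensor only involves
  the diagonal blocks of the curvature, one on the base and one on the fiber
  (`fst_curvatureEnd_localWarped`, `snd_curvatureEnd_localWarped`). This gives
  `Ric = Ric_G - (m / f) Hess f + Ric_K - (f Δf + (m - 1) |∇f|²) K` (`localRicci_localWarped`) and
  `Hess h = Hess_G h + f dh(∇f) K` (`localHessian_localWarped`).
* For a conformally flat metric `φ⁻² η`, the same method yields the curvature and
  `Ric = (n - 2) φ⁻¹ D²φ + (φ⁻¹ Δφ - (n - 1) φ⁻² |∇φ|²) η`, gradient, norm and Laplacian being those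
  of `η` (`localRicci_localConformal`), and formulas for Hessians, gradients and Laplacians.

Together they show that `Ric + Hess h - ρ g` is the sum of a tensor on the base and of a multiple of
the metric of the fiber, the factor being a function on the base
(`ricci_add_hessian_sub_warpedProduct`). Since the fiber is non-empty of positive dimension and its
metric is nondegenerate, the sum vanishes everywhere if and only if both the tensor and the function
do (`isGradientRicciSoliton_iff`). The off-diagonal and diagonal entries of the matrix of the tensor,
multiplied by `f φ²`, are the first two families of equations (the off-diagonal ones times `φ`), and
the vanishing of the function is the third.
-/

noncomputable section

set_option maxSynthPendingDepth 3

namespace SemiRiem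

/-! ### Semi-Riemannian metrics on open sets of a vector space -/

section LocalMetric

variable {E : Type*} [NormedAddCommGroup E] [NormedSpace ℝ E]

/-- `G` is a smooth semi-Riemannian metric on the open subset `U` of the vector space `E`. -/
structure IsLocalMetricOn (G : E → E →L[ℝ] E →L[ℝ] ℝ) (U : Set E) : Prop where
  isOpen : IsOpen U
  symm : ∀ y ∈ U, ∀ v w, G y v w = G y w v
  nondegenerate : ∀ y ∈ U, ∀ v, (∀ w, G y v w = 0) → v = 0
  smooth : ContDiffOn ℝ ∞ G U

/-- The gradient of `k` with respect to `G`: the vector field dual to `dk`. It is zero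
where `G` is not invertible as a map to the dual space. -/
def localGradient (G : E → E →L[ℝ] E →L[ℝ] ℝ) (k : E → ℝ) (y : E) : E :=
  (G y).inverse (fderiv ℝ k y)

/-- The covariant derivative `u ↦ ∇_u X` of the vector field `X` at `y`, for the Levi-Civita
connection of `G`. -/
def localCovariantDeriv (G : E → E →L[ℝ] E →L[ℝ] ℝ) (X : E → E) (y : E) : E →ₗ[ℝ] E where
  toFun u := fderiv ℝ X y u + christoffel G y u (X y)
  map_add' a b := by
    simp only [map_add, add_apply]
    abel
  map_smul' c a := by
    simp only [map_smul, smul_apply, RingHom.id_apply, smul_add]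

/-- The Laplacian of `k` with respect to `G`: the divergence of the gradient. -/
def localLaplacian (G : E → E →L[ℝ] E →L[ℝ] ℝ) (k : E → ℝ) (y : E) : ℝ :=
  LinearMap.trace ℝ E (localCovariantDeriv G (localGradient G k) y)

/-- Differentiating a field of bilinear maps commutes with evaluating it at constant vectors. -/
theorem fderiv_apply_apply {V W X : Type*} [NormedAddCommGroup V] [NormedSpace ℝ V]
    [NormedAddCommGroup W] [NormedSpace ℝ W] [NormedAddCommGroup X] [NormedSpace ℝ X]
    {T : E → V →L[ℝ] W →L[ℝ] X} {y : E} (hT : DifferentiableAt ℝ T y) (u : E) (v : V) (w : W) :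
    fderiv ℝ T y u v w = fderiv ℝ (fun z => T z v w) y u := by
  have h := ((hT.hasFDerivAt.clm_apply (hasFDerivAt_const v y)).clm_apply (hasFDerivAt_const w y))
  rw [h.fderiv]
  simp

theorem differentiableAt_fderiv {V : Type*} [NormedAddCommGroup V] [NormedSpace ℝ V] {k : E → V}
    {y : E} (hk : ContDiffAt ℝ ∞ k y) : DifferentiableAt ℝ (fderiv ℝ k) y :=
  (hk.fderiv_right (m := 1) (WithTop.coe_le_coe.2 le_top)).differentiableAt one_ne_zero

theorem isInvertible_of_nondegenerate [FiniteDimensional ℝ E] {b : E →L[ℝ] E →L[ℝ] ℝ}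
    (hb : ∀ v, (∀ w, b v w = 0) → v = 0) : b.IsInvertible := by
  have hinj : Function.Injective b := by
    rw [injective_iff_map_eq_zero]
    intro a ha
    exact hb a fun w => by rw [ha]; rfl
  have hdim : Module.finrank ℝ E = Module.finrank ℝ (E →L[ℝ] ℝ) := by
    rw [← (LinearMap.toContinuousLinearMap (𝕜 := ℝ) (E := E) (F' := ℝ)).finrank_eq]
    exact (Subspace.dual_finrank_eq (K := ℝ) (V := E)).symm
  refine ⟨(LinearEquiv.ofInjectiveOfFinrankEq (b : E →ₗ[ℝ] (E →L[ℝ] ℝ)) hinj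
    hdim).toContinuousLinearEquiv, ?_⟩
  ext a c
  rfl

namespace IsLocalMetricOn

variable {G : E → E →L[ℝ] E →L[ℝ] ℝ} {U : Set E}

theorem mem_nhds (hG : IsLocalMetricOn G U) {y : E} (hy : y ∈ U) : U ∈ nhds y :=
  hG.isOpen.mem_nhds hy

theorem contDiffAt (hG : IsLocalMetricOn G U) {y : E} (hy : y ∈ U) : ContDiffAt ℝ ∞ G y :=
  hG.smooth.contDiffAt (hG.mem_nhds hy)

theorem differentiableAt (hG : IsLocalMetricOn G U) {y : E} (hy : y ∈ U) :
    DifferentiableAt ℝ G y :=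
  (hG.contDiffAt hy).differentiableAt (by simp)

theorem fderiv_symm (hG : IsLocalMetricOn G U) {y : E} (hy : y ∈ U) (u v w : E) :
    fderiv ℝ G y u v w = fderiv ℝ G y u w v := by
  rw [fderiv_apply_apply (hG.differentiableAt hy), fderiv_apply_apply (hG.differentiableAt hy)]
  have h : (fun z => G z v w) =ᶠ[nhds y] fun z => G z w v :=
    Filter.eventuallyEq_of_mem (hG.mem_nhds hy) fun z hz => hG.symm z hz v w
  rw [h.fderiv_eq]

variable [FiniteDimensional ℝ E]

theorem isInvertible (hG : IsLocalMetricOn G U) {y : E} (hy : y ∈ U) : (G y).IsInvertible :=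
  isInvertible_of_nondegenerate (hG.nondegenerate y hy)

/-- The defining property of the Christoffel symbols determines them. -/
theorem christoffel_eq (hG : IsLocalMetricOn G U) {y : E} (hy : y ∈ U) {u v z : E}
    (hz : ∀ w, G y z w = christoffelFirst G y u v w) : christoffel G y u v = z := by
  rw [christoffel_apply, (hG.isInvertible hy).inverse_apply_eq]
  ext w
  exact (hz w).symm

/-- The Levi-Civita connection is torsion free. -/
theorem christoffel_symm (hG : IsLocalMetricOn G U) {y : E} (hy : y ∈ U) (u v : E) :
    christoffel G y u v = christoffel G y v u := by
  refine hG.christoffel_eq hy fun w => ?_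
  rw [apply_christoffel G y (hG.nondegenerate y hy), christoffelFirst_apply,
    christoffelFirst_apply, hG.fderiv_symm hy w u v]
  ring

theorem contDiffAt_inverse (hG : IsLocalMetricOn G U) {y : E} (hy : y ∈ U) :
    ContDiffAt ℝ ∞ (fun z => (G z).inverse) y :=
  ((hG.isInvertible hy).contDiffAt_map_inverse).comp y (hG.contDiffAt hy)

theorem differentiableAt_christoffel (hG : IsLocalMetricOn G U) {y : E} (hy : y ∈ U) :
    DifferentiableAt ℝ (christoffel G) y := by
  have h1 : DifferentiableAt ℝ (fderiv ℝ G) y :=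
    differentiableAt_fderiv (hG.contDiffAt hy)
  have h2 : DifferentiableAt ℝ (fun z => (G z).inverse) y :=
    (hG.contDiffAt_inverse hy).differentiableAt (by simp)
  have h3 : DifferentiableAt ℝ (fun z => (fderiv ℝ G z).flip) y :=
    (ContinuousLinearMap.flipₗᵢ ℝ E E (E →L[ℝ] ℝ)).toContinuousLinearEquiv.differentiableAt.comp
      y h1
  have h4 : DifferentiableAt ℝ (christoffelFirst G) y :=
    ((h1.add h3).sub ((differentiableAt_const
      (ContinuousLinearMap.flipₗᵢ ℝ E E ℝ).toContinuousLinearEquiv.toContinuousLinearMap).clm_comp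
        h3)).const_smul (1 / 2 : ℝ)
  exact ((ContinuousLinearMap.compL ℝ E (E →L[ℝ] ℝ) E).differentiableAt.comp y h2).clm_comp h4

theorem differentiableAt_localGradient (hG : IsLocalMetricOn G U) {y : E} (hy : y ∈ U)
    {k : E → ℝ} (hk : ContDiffAt ℝ ∞ k y) : DifferentiableAt ℝ (localGradient G k) y :=
  ((hG.contDiffAt_inverse hy).differentiableAt (by simp)).clm_apply
    (differentiableAt_fderiv hk)

theorem apply_localGradient (hG : IsLocalMetricOn G U) {y : E} (hy : y ∈ U) (k : E → ℝ) (w : E) :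
    G y (localGradient G k y) w = fderiv ℝ k y w := by
  have h : G y (localGradient G k y) = fderiv ℝ k y :=
    ((hG.isInvertible hy).inverse_apply_eq.1 rfl).symm
  rw [h]

theorem localGradient_eq (hG : IsLocalMetricOn G U) {y : E} (hy : y ∈ U) {k : E → ℝ} {z : E}
    (hz : ∀ w, G y z w = fderiv ℝ k y w) : localGradient G k y = z := by
  rw [localGradient, (hG.isInvertible hy).inverse_apply_eq]
  ext w
  exact (hz w).symm

/-- The curvature in terms of the derivatives of the vector fields `∇_v w`, which unlike
`christoffel` itself have explicit formulas for the metrics considered below. -/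
theorem curvatureEnd_apply (hG : IsLocalMetricOn G U) {y : E} (hy : y ∈ U) (u v w : E) :
    curvatureEnd G y v w u = fderiv ℝ (fun z => christoffel G z v w) y u
      - fderiv ℝ (fun z => christoffel G z u w) y v
      + christoffel G y u (christoffel G y v w) - christoffel G y v (christoffel G y u w) := by
  rw [← fderiv_apply_apply (hG.differentiableAt_christoffel hy),
    ← fderiv_apply_apply (hG.differentiableAt_christoffel hy)]
  rfl

end IsLocalMetricOn

/-- The Christoffel symbols of metrics which agree near a point agree near that point. -/
theorem christoffel_congr {G G' : E → E →L[ℝ] E →L[ℝ] ℝ} {y : E} (h : G =ᶠ[nhds y] G') :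
    christoffel G =ᶠ[nhds y] christoffel G' := by
  filter_upwards [h, h.fderiv (𝕜 := ℝ)] with z h1 h2
  rw [christoffel, christoffel, christoffelFirst, christoffelFirst, h1, h2]

theorem localRicci_congr {G G' : E → E →L[ℝ] E →L[ℝ] ℝ} {y : E} (h : G =ᶠ[nhds y] G') (v w : E) :
    localRicci G y v w = localRicci G' y v w := by
  have h1 := christoffel_congr h
  have h2 : curvatureEnd G y v w = curvatureEnd G' y v w := by
    ext u
    simp only [curvatureEnd, LinearMap.coe_mk, AddHom.coe_mk, h1.eq_of_nhds, h1.fderiv_eq]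
  rw [localRicci, localRicci, h2]

theorem localHessian_congr {G G' : E → E →L[ℝ] E →L[ℝ] ℝ} {y : E} (h : G =ᶠ[nhds y] G')
    (k : E → ℝ) (v w : E) : localHessian G k y v w = localHessian G' k y v w := by
  rw [localHessian, localHessian, (christoffel_congr h).eq_of_nhds]

/-- The trace of an endomorphism of a product is the sum of the traces of its diagonal blocks. -/
theorem trace_prod_eq {V W : Type*} [AddCommGroup V] [Module ℝ V] [FiniteDimensional ℝ V]
    [AddCommGroup W] [Module ℝ W] [FiniteDimensional ℝ W] (T : V × W →ₗ[ℝ] V × W) :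
    LinearMap.trace ℝ (V × W) T =
      LinearMap.trace ℝ V (LinearMap.fst ℝ V W ∘ₗ T ∘ₗ LinearMap.inl ℝ V W) +
        LinearMap.trace ℝ W (LinearMap.snd ℝ V W ∘ₗ T ∘ₗ LinearMap.inr ℝ V W) := by
  have h : T = (T ∘ₗ LinearMap.inl ℝ V W) ∘ₗ LinearMap.fst ℝ V W
      + (T ∘ₗ LinearMap.inr ℝ V W) ∘ₗ LinearMap.snd ℝ V W := by
    refine LinearMap.ext fun x => ?_
    simp [← map_add]
  conv_lhs => rw [h, map_add]
  exact congrArg₂ (· + ·) (LinearMap.trace_comp_comm' _ _) (LinearMap.trace_comp_comm' _ _)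

end LocalMetric

/-! ### The Levi-Civita connection of a warped product -/

section LocalWarped

variable {E : Type*} [NormedAddCommGroup E] [NormedSpace ℝ E]
  {E' : Type*} [NormedAddCommGroup E'] [NormedSpace ℝ E']

/-- The warped product metric `G + f² K` on `E × E'`. -/
def localWarped (G : E → E →L[ℝ] E →L[ℝ] ℝ) (K : E' → E' →L[ℝ] E' →L[ℝ] ℝ) (f : E → ℝ)
    (y : E × E') : E × E' →L[ℝ] E × E' →L[ℝ] ℝ :=
  pullbackForm (G y.1) (ContinuousLinearMap.fst ℝ E E')
    + (f y.1 ^ 2) • pullbackForm (K y.2) (ContinuousLinearMap.snd ℝ E E')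

theorem localWarped_apply (G : E → E →L[ℝ] E →L[ℝ] ℝ) (K : E' → E' →L[ℝ] E' →L[ℝ] ℝ) (f : E → ℝ)
    (y v w : E × E') :
    localWarped G K f y v w = G y.1 v.1 w.1 + f y.1 ^ 2 * K y.2 v.2 w.2 := rfl

variable {G : E → E →L[ℝ] E →L[ℝ] ℝ} {U : Set E} {K : E' → E' →L[ℝ] E' →L[ℝ] ℝ} {T : Set E'}
  {f : E → ℝ}

theorem IsLocalMetricOn.localWarped (hG : IsLocalMetricOn G U) (hK : IsLocalMetricOn K T)
    (hf : ContDiffOn ℝ ∞ f U) (hf0 : ∀ x ∈ U, f x ≠ 0) :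
    IsLocalMetricOn (localWarped G K f) (U ×ˢ T) where
  isOpen := hG.isOpen.prod hK.isOpen
  symm y hy v w := by
    rw [localWarped_apply, localWarped_apply, hG.symm _ hy.1, hK.symm _ hy.2]
  nondegenerate y hy v hv := by
    refine Prod.ext (hG.nondegenerate _ hy.1 _ fun w => ?_) (hK.nondegenerate _ hy.2 _ fun w => ?_)
    · simpa [localWarped_apply] using hv (w, 0)
    · simpa [localWarped_apply, hf0 _ hy.1] using hv (0, w)
  smooth := by
    have hB : Set.MapsTo Prod.fst (U ×ˢ T) U := fun y hy => hy.1
    have hF : Set.MapsTo Prod.snd (U ×ˢ T) T := fun y hy => hy.2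
    exact (contDiffOn_pullbackForm (hG.smooth.comp contDiffOn_fst hB) _).add
      (((hf.comp contDiffOn_fst hB).pow 2).smul
        (contDiffOn_pullbackForm (hK.smooth.comp contDiffOn_snd hF) _))

theorem hasFDerivAt_comp_fst {V : Type*} [NormedAddCommGroup V] [NormedSpace ℝ V] {k : E → V}
    {y : E × E'} (hk : DifferentiableAt ℝ k y.1) :
    HasFDerivAt (fun z : E × E' => k z.1)
      ((fderiv ℝ k y.1).comp (ContinuousLinearMap.fst ℝ E E')) y :=
  hk.hasFDerivAt.comp y hasFDerivAt_fst

theorem hasFDerivAt_comp_snd {V : Type*} [NormedAddCommGroup V] [NormedSpace ℝ V] {k : E' → V}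
    {y : E × E'} (hk : DifferentiableAt ℝ k y.2) :
    HasFDerivAt (fun z : E × E' => k z.2)
      ((fderiv ℝ k y.2).comp (ContinuousLinearMap.snd ℝ E E')) y :=
  hk.hasFDerivAt.comp y hasFDerivAt_snd

theorem differentiableAt_apply_apply {V W X : Type*} [NormedAddCommGroup V] [NormedSpace ℝ V]
    [NormedAddCommGroup W] [NormedSpace ℝ W] [NormedAddCommGroup X] [NormedSpace ℝ X]
    {S : E → V →L[ℝ] W →L[ℝ] X} {y : E} (hS : DifferentiableAt ℝ S y) (v : V) (w : W) :
    DifferentiableAt ℝ (fun z => S z v w) y :=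
  (hS.clm_apply (differentiableAt_const v)).clm_apply (differentiableAt_const w)

theorem fderiv_localWarped (hG : IsLocalMetricOn G U) (hK : IsLocalMetricOn K T)
    (hf : ContDiffOn ℝ ∞ f U) (hf0 : ∀ x ∈ U, f x ≠ 0) {y : E × E'} (hy : y ∈ U ×ˢ T)
    (u v w : E × E') :
    fderiv ℝ (localWarped G K f) y u v w = fderiv ℝ G y.1 u.1 v.1 w.1
      + 2 * f y.1 * fderiv ℝ f y.1 u.1 * K y.2 v.2 w.2
      + f y.1 ^ 2 * fderiv ℝ K y.2 u.2 v.2 w.2 := by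
  have hfd : DifferentiableAt ℝ f y.1 :=
    (hf.contDiffAt (hG.mem_nhds hy.1)).differentiableAt (by simp)
  rw [fderiv_apply_apply ((hG.localWarped hK hf hf0).differentiableAt hy),
    fderiv_apply_apply (hG.differentiableAt hy.1), fderiv_apply_apply (hK.differentiableAt hy.2)]
  have h1 := hasFDerivAt_comp_fst (y := y)
    (differentiableAt_apply_apply (hG.differentiableAt hy.1) v.1 w.1)
  have h2 := hasFDerivAt_comp_fst (y := y) hfd
  have h3 := hasFDerivAt_comp_snd (y := y)
    (differentiableAt_apply_apply (hK.differentiableAt hy.2) v.2 w.2)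
  have h := h1.add ((h2.pow 2).mul h3)
  refine (congrArg (fun A => A u) h.fderiv).trans ?_
  simp
  ring

variable [FiniteDimensional ℝ E] [FiniteDimensional ℝ E']

/-- The Levi-Civita connection of a warped product. -/
theorem christoffel_localWarped (hG : IsLocalMetricOn G U) (hK : IsLocalMetricOn K T)
    (hf : ContDiffOn ℝ ∞ f U) (hf0 : ∀ x ∈ U, f x ≠ 0) {y : E × E'} (hy : y ∈ U ×ˢ T)
    (u v : E × E') :
    christoffel (localWarped G K f) y u v =
      (christoffel G y.1 u.1 v.1 - (f y.1 * K y.2 u.2 v.2) • localGradient G f y.1,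
       christoffel K y.2 u.2 v.2 + ((f y.1)⁻¹ * fderiv ℝ f y.1 u.1) • v.2
        + ((f y.1)⁻¹ * fderiv ℝ f y.1 v.1) • u.2) := by
  refine (hG.localWarped hK hf hf0).christoffel_eq hy fun w => ?_
  have h0 := hf0 _ hy.1
  rw [localWarped_apply, christoffelFirst_apply]
  simp only [fderiv_localWarped hG hK hf hf0 hy, map_add, map_sub, map_smul, add_apply, sub_apply,
    smul_apply, smul_eq_mul, hG.apply_localGradient hy.1,
    apply_christoffel G y.1 (hG.nondegenerate _ hy.1),
    apply_christoffel K y.2 (hK.nondegenerate _ hy.2), christoffelFirst_apply]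
  field_simp
  ring

/-- The derivative in the direction `u` of the vector field `∇_v w` on a warped product, for
constant `v` and `w`. -/
theorem fderiv_christoffel_localWarped (hG : IsLocalMetricOn G U) (hK : IsLocalMetricOn K T)
    (hf : ContDiffOn ℝ ∞ f U) (hf0 : ∀ x ∈ U, f x ≠ 0) {y : E × E'} (hy : y ∈ U ×ˢ T)
    (u v w : E × E') :
    fderiv ℝ (fun z => christoffel (localWarped G K f) z v w) y u =
      (fderiv ℝ (fun z => christoffel G z v.1 w.1) y.1 u.1
          - (f y.1 * K y.2 v.2 w.2) • fderiv ℝ (localGradient G f) y.1 u.1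
          - (f y.1 * fderiv ℝ (fun z => K z v.2 w.2) y.2 u.2
            + K y.2 v.2 w.2 * fderiv ℝ f y.1 u.1) • localGradient G f y.1,
       fderiv ℝ (fun z => christoffel K z v.2 w.2) y.2 u.2
        + ((f y.1)⁻¹ * fderiv ℝ (fderiv ℝ f) y.1 u.1 v.1
            - (f y.1 ^ 2)⁻¹ * fderiv ℝ f y.1 u.1 * fderiv ℝ f y.1 v.1) • w.2
        + ((f y.1)⁻¹ * fderiv ℝ (fderiv ℝ f) y.1 u.1 w.1
            - (f y.1 ^ 2)⁻¹ * fderiv ℝ f y.1 u.1 * fderiv ℝ f y.1 w.1) • v.2) := by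
  have hfc := hf.contDiffAt (hG.mem_nhds hy.1)
  have hfd : DifferentiableAt ℝ f y.1 := hfc.differentiableAt (by simp)
  have h2f := differentiableAt_fderiv hfc
  have hev : (fun z => christoffel (localWarped G K f) z v w) =ᶠ[nhds y] fun z =>
      (christoffel G z.1 v.1 w.1 - (f z.1 * K z.2 v.2 w.2) • localGradient G f z.1,
       christoffel K z.2 v.2 w.2 + ((f z.1)⁻¹ * fderiv ℝ f z.1 v.1) • w.2
        + ((f z.1)⁻¹ * fderiv ℝ f z.1 w.1) • v.2) :=
    Filter.eventuallyEq_of_mem ((hG.localWarped hK hf hf0).mem_nhds hy) fun z hz =>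
      christoffel_localWarped hG hK hf hf0 hz v w
  have a1 := hasFDerivAt_comp_fst (y := y)
    (differentiableAt_apply_apply (hG.differentiableAt_christoffel hy.1) v.1 w.1)
  have a2 := hasFDerivAt_comp_fst (y := y) hfd
  have a3 := hasFDerivAt_comp_snd (y := y)
    (differentiableAt_apply_apply (hK.differentiableAt hy.2) v.2 w.2)
  have a4 := hasFDerivAt_comp_fst (y := y) (hG.differentiableAt_localGradient hy.1 hfc)
  have a5 := hasFDerivAt_comp_snd (y := y)
    (differentiableAt_apply_apply (hK.differentiableAt_christoffel hy.2) v.2 w.2)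
  -- The coefficients `df(a) / f` of the fiber component.
  have a6 : ∀ a : E, HasFDerivAt (fun z : E × E' => (f z.1)⁻¹ * fderiv ℝ f z.1 a) _ y := fun a =>
    ((hasDerivAt_inv (hf0 _ hy.1)).comp_hasFDerivAt y a2).mul
      ((hasFDerivAt_comp_fst (y := y) h2f).clm_apply (hasFDerivAt_const a y))
  have h := (a1.sub ((a2.mul a3).smul a4)).prodMk
    ((a5.add ((a6 v.1).smul_const w.2)).add ((a6 w.1).smul_const v.2))
  rw [hev.fderiv_eq]
  refine (congrArg (fun A => A u) h.fderiv).trans ?_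
  refine Prod.ext ?_ ?_
  · simp
    module
  · simp
    module

end LocalWarped

/-! ### The Ricci tensor and Hessians on a warped product -/

section LocalWarpedRicci

variable {E : Type*} [NormedAddCommGroup E] [NormedSpace ℝ E] [FiniteDimensional ℝ E]
  {E' : Type*} [NormedAddCommGroup E'] [NormedSpace ℝ E'] [FiniteDimensional ℝ E']
  {G : E → E →L[ℝ] E →L[ℝ] ℝ} {U : Set E} {K : E' → E' →L[ℝ] E' →L[ℝ] ℝ} {T : Set E'}
  {f : E → ℝ}

/-- The block of `u ↦ R(u, v) w` on the tangent space of the base of a warped product. -/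
theorem fst_curvatureEnd_localWarped (hG : IsLocalMetricOn G U) (hK : IsLocalMetricOn K T)
    (hf : ContDiffOn ℝ ∞ f U) (hf0 : ∀ x ∈ U, f x ≠ 0) {y : E × E'} (hy : y ∈ U ×ˢ T)
    (v w : E × E') (a : E) :
    (curvatureEnd (localWarped G K f) y v w (a, 0)).1 = curvatureEnd G y.1 v.1 w.1 a
      - (f y.1 * K y.2 v.2 w.2) • localCovariantDeriv G (localGradient G f) y.1 a := by
  have h0 := hf0 _ hy.1
  rw [(hG.localWarped hK hf hf0).curvatureEnd_apply hy, hG.curvatureEnd_apply hy.1]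
  simp only [fderiv_christoffel_localWarped hG hK hf hf0 hy,
    christoffel_localWarped hG hK hf hf0 hy, localCovariantDeriv, LinearMap.coe_mk, AddHom.coe_mk,
    map_zero, zero_apply, map_sub, map_add, map_smul, Prod.fst_add, Prod.fst_sub, smul_eq_mul,
    mul_zero, zero_smul, smul_zero, add_zero, sub_zero, zero_add, fderiv_fun_const, Pi.zero_apply]
  match_scalars <;> field_simp
  ring

/-- The block of `u ↦ R(u, v) w` on the tangent space of the fiber of a warped product. -/
theorem snd_curvatureEnd_localWarped (hG : IsLocalMetricOn G U) (hK : IsLocalMetricOn K T)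
    (hf : ContDiffOn ℝ ∞ f U) (hf0 : ∀ x ∈ U, f x ≠ 0) {y : E × E'} (hy : y ∈ U ×ˢ T)
    (v w : E × E') (b : E') :
    (curvatureEnd (localWarped G K f) y v w (0, b)).2 = curvatureEnd K y.2 v.2 w.2 b
      - ((f y.1)⁻¹ * localHessian G f y.1 v.1 w.1
          + K y.2 v.2 w.2 * fderiv ℝ f y.1 (localGradient G f y.1)) • b
      + (fderiv ℝ f y.1 (localGradient G f y.1) * K y.2 b w.2) • v.2 := by
  have h0 := hf0 _ hy.1
  rw [(hG.localWarped hK hf hf0).curvatureEnd_apply hy, hK.curvatureEnd_apply hy.2]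
  simp only [fderiv_christoffel_localWarped hG hK hf hf0 hy,
    christoffel_localWarped hG hK hf hf0 hy, localHessian,
    map_zero, zero_apply, map_sub, map_add, map_smul, Prod.snd_add, Prod.snd_sub, smul_eq_mul,
    mul_zero, zero_smul, smul_zero, add_zero, sub_zero, hK.christoffel_symm hy.2 b v.2]
  match_scalars <;> field_simp <;> ring

/-- The Ricci tensor of a warped product. -/
theorem localRicci_localWarped (hG : IsLocalMetricOn G U) (hK : IsLocalMetricOn K T)
    (hf : ContDiffOn ℝ ∞ f U) (hf0 : ∀ x ∈ U, f x ≠ 0) {y : E × E'} (hy : y ∈ U ×ˢ T)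
    (v w : E × E') :
    localRicci (localWarped G K f) y v w = localRicci G y.1 v.1 w.1
      - Module.finrank ℝ E' * (f y.1)⁻¹ * localHessian G f y.1 v.1 w.1
      + localRicci K y.2 v.2 w.2
      - (f y.1 * localLaplacian G f y.1
          + (Module.finrank ℝ E' - 1) * fderiv ℝ f y.1 (localGradient G f y.1))
        * K y.2 v.2 w.2 := by
  have h1 : LinearMap.fst ℝ E E' ∘ₗ curvatureEnd (localWarped G K f) y v w ∘ₗ LinearMap.inl ℝ E E' =
      curvatureEnd G y.1 v.1 w.1
        - (f y.1 * K y.2 v.2 w.2) • localCovariantDeriv G (localGradient G f) y.1 :=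
    LinearMap.ext fun a => fst_curvatureEnd_localWarped hG hK hf hf0 hy v w a
  have h2 : LinearMap.snd ℝ E E' ∘ₗ curvatureEnd (localWarped G K f) y v w ∘ₗ LinearMap.inr ℝ E E' =
      curvatureEnd K y.2 v.2 w.2
        - ((f y.1)⁻¹ * localHessian G f y.1 v.1 w.1
          + K y.2 v.2 w.2 * fderiv ℝ f y.1 (localGradient G f y.1)) • LinearMap.id
        + fderiv ℝ f y.1 (localGradient G f y.1) •
          ((K y.2).flip w.2 : E' →ₗ[ℝ] ℝ).smulRight v.2 := by
    refine LinearMap.ext fun b => (snd_curvatureEnd_localWarped hG hK hf hf0 hy v w b).trans ?_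
    simp [mul_smul]
  rw [localRicci, trace_prod_eq, h1, h2]
  simp only [map_sub, map_add, map_smul, LinearMap.trace_id, LinearMap.trace_smulRight,
    smul_eq_mul, localRicci, localLaplacian, ContinuousLinearMap.coe_coe,
    ContinuousLinearMap.flip_apply]
  ring

/-- The Hessian of a function on the base, regarded as a function on the warped product. -/
theorem localHessian_localWarped (hG : IsLocalMetricOn G U) (hK : IsLocalMetricOn K T)
    (hf : ContDiffOn ℝ ∞ f U) (hf0 : ∀ x ∈ U, f x ≠ 0) {k : E → ℝ} (hk : ContDiffOn ℝ ∞ k U)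
    {y : E × E'} (hy : y ∈ U ×ˢ T) (v w : E × E') :
    localHessian (localWarped G K f) (fun z => k z.1) y v w = localHessian G k y.1 v.1 w.1
      + f y.1 * fderiv ℝ k y.1 (localGradient G f y.1) * K y.2 v.2 w.2 := by
  have h1 : ∀ z ∈ U ×ˢ T, fderiv ℝ (fun z : E × E' => k z.1) z =
      (fderiv ℝ k z.1).comp (ContinuousLinearMap.fst ℝ E E') := fun z hz =>
    (hasFDerivAt_comp_fst (y := z)
      ((hk.contDiffAt (hG.mem_nhds hz.1)).differentiableAt (by simp))).fderiv
  have h2 : fderiv ℝ (fun z : E × E' => k z.1) =ᶠ[nhds y] fun z : E × E' =>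
      (fderiv ℝ k z.1).comp (ContinuousLinearMap.fst ℝ E E') :=
    Filter.eventuallyEq_of_mem ((hG.localWarped hK hf hf0).mem_nhds hy) h1
  have h3 := (hasFDerivAt_comp_fst (y := y)
    (differentiableAt_fderiv (hk.contDiffAt (hG.mem_nhds hy.1)))).clm_comp
      (hasFDerivAt_const (ContinuousLinearMap.fst ℝ E E') y)
  rw [localHessian, localHessian, h2.fderiv_eq, h3.fderiv, h1 y hy,
    christoffel_localWarped hG hK hf hf0 hy]
  simp
  ring

end LocalWarpedRicci

/-! ### Metrics conformal to a constant metric -/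

section LocalConformal

variable {E : Type*} [NormedAddCommGroup E] [NormedSpace ℝ E]

/-- The metric `φ⁻² η`, conformal to the constant metric `η`. -/
def localConformal (η : E →L[ℝ] E →L[ℝ] ℝ) (φ : E → ℝ) (y : E) : E →L[ℝ] E →L[ℝ] ℝ :=
  (φ y ^ 2)⁻¹ • η

theorem localConformal_apply (η : E →L[ℝ] E →L[ℝ] ℝ) (φ : E → ℝ) (y v w : E) :
    localConformal η φ y v w = (φ y ^ 2)⁻¹ * η v w := rfl

/-- The trace of the bilinear form `b` with respect to the nondegenerate bilinear form `η`:
the trace of the endomorphism obtained from `b` by raising an index with `η`. -/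
def formTrace (η b : E →L[ℝ] E →L[ℝ] ℝ) : ℝ :=
  LinearMap.trace ℝ E (η.inverse.comp b).toLinearMap

variable {η : E →L[ℝ] E →L[ℝ] ℝ} {φ : E → ℝ}

theorem isLocalMetricOn_localConformal (hs : ∀ v w, η v w = η w v)
    (hn : ∀ v, (∀ w, η v w = 0) → v = 0) (hφ : ContDiff ℝ ∞ φ) (hφ0 : ∀ x, φ x ≠ 0) :
    IsLocalMetricOn (localConformal η φ) Set.univ where
  isOpen := isOpen_univ
  symm y _ v w := by rw [localConformal_apply, localConformal_apply, hs]
  nondegenerate y _ v hv := hn v fun w => by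
    simpa [localConformal_apply, hφ0 y] using hv w
  smooth := (((hφ.pow 2).inv fun y => pow_ne_zero 2 (hφ0 y)).smul contDiff_const).contDiffOn

theorem fderiv_localConformal (hφ : ContDiff ℝ ∞ φ) (hφ0 : ∀ x, φ x ≠ 0) (y u v w : E) :
    fderiv ℝ (localConformal η φ) y u v w = -2 * (φ y ^ 3)⁻¹ * fderiv ℝ φ y u * η v w := by
  have h1 : HasFDerivAt φ (fderiv ℝ φ y) y := (hφ.differentiable (by simp) y).hasFDerivAt
  have h := ((hasDerivAt_inv (pow_ne_zero 2 (hφ0 y))).comp_hasFDerivAt y (h1.pow 2)).smul_const η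
  refine (congrArg (fun A => A u v w) h.fderiv).trans ?_
  have h0 := hφ0 y
  simp
  field_simp
  simp

variable [FiniteDimensional ℝ E]

theorem apply_inverse_of_nondegenerate (hn : ∀ v, (∀ w, η v w = 0) → v = 0) (β : E →L[ℝ] ℝ)
    (w : E) : η (η.inverse β) w = β w := by
  have h : β = η (η.inverse β) := (isInvertible_of_nondegenerate hn).inverse_apply_eq.1 rfl
  rw [← h]

/-- The symmetry of the bilinear form induced by `η` on the dual space. -/
theorem apply_inverse_comm (hs : ∀ v w, η v w = η w v) (hn : ∀ v, (∀ w, η v w = 0) → v = 0)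
    (β γ : E →L[ℝ] ℝ) : β (η.inverse γ) = γ (η.inverse β) := by
  rw [← apply_inverse_of_nondegenerate hn β, hs, apply_inverse_of_nondegenerate hn]

/-- The Levi-Civita connection of a conformally flat metric; `η.inverse (dφ)` is the gradient of `φ`
with respect to `η`. -/
theorem christoffel_localConformal (hs : ∀ v w, η v w = η w v)
    (hn : ∀ v, (∀ w, η v w = 0) → v = 0) (hφ : ContDiff ℝ ∞ φ) (hφ0 : ∀ x, φ x ≠ 0) (y u v : E) :
    christoffel (localConformal η φ) y u v =
      -((φ y)⁻¹ * fderiv ℝ φ y u) • v - ((φ y)⁻¹ * fderiv ℝ φ y v) • u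
        + ((φ y)⁻¹ * η u v) • η.inverse (fderiv ℝ φ y) := by
  refine (isLocalMetricOn_localConformal hs hn hφ hφ0).christoffel_eq (Set.mem_univ y) fun w => ?_
  have h0 := hφ0 y
  rw [localConformal_apply, christoffelFirst_apply]
  simp only [fderiv_localConformal hφ hφ0, map_add, map_sub, map_smul, add_apply, sub_apply,
    smul_apply, smul_eq_mul, apply_inverse_of_nondegenerate hn]
  field_simp
  ring

/-- The derivative in the direction `u` of the vector field `∇_v w` of a conformally flat metric, for
constant `v` and `w`. -/
theorem fderiv_christoffel_localConformal (hs : ∀ v w, η v w = η w v)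
    (hn : ∀ v, (∀ w, η v w = 0) → v = 0) (hφ : ContDiff ℝ ∞ φ) (hφ0 : ∀ x, φ x ≠ 0)
    (y u v w : E) :
    fderiv ℝ (fun z => christoffel (localConformal η φ) z v w) y u =
      -((φ y)⁻¹ * fderiv ℝ (fderiv ℝ φ) y u v
          - (φ y ^ 2)⁻¹ * fderiv ℝ φ y u * fderiv ℝ φ y v) • w
        - ((φ y)⁻¹ * fderiv ℝ (fderiv ℝ φ) y u w
          - (φ y ^ 2)⁻¹ * fderiv ℝ φ y u * fderiv ℝ φ y w) • v
        + η v w • ((φ y)⁻¹ • η.inverse (fderiv ℝ (fderiv ℝ φ) y u)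
          - ((φ y ^ 2)⁻¹ * fderiv ℝ φ y u) • η.inverse (fderiv ℝ φ y)) := by
  have h1 : HasFDerivAt φ (fderiv ℝ φ y) y := (hφ.differentiable (by simp) y).hasFDerivAt
  have h2 := (differentiableAt_fderiv (y := y) hφ.contDiffAt).hasFDerivAt
  have h3 := (hasDerivAt_inv (hφ0 y)).comp_hasFDerivAt y h1
  have h4 : ∀ a : E, HasFDerivAt (fun z => (φ z)⁻¹ * fderiv ℝ φ z a) _ y := fun a =>
    h3.mul (h2.clm_apply (hasFDerivAt_const a y))
  have h5 : HasFDerivAt (fun z => η.inverse (fderiv ℝ φ z)) _ y :=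
    η.inverse.hasFDerivAt.comp y h2
  have h := (((h4 v).neg.smul_const w).sub ((h4 w).smul_const v)).add
    ((h3.mul_const (η v w)).smul h5)
  have he : (fun z => christoffel (localConformal η φ) z v w) = _ :=
    funext fun z => christoffel_localConformal hs hn hφ hφ0 z v w
  rw [he]
  refine (congrArg (fun A => A u) h.fderiv).trans ?_
  simp
  module

/-- The curvature of a conformally flat metric. All products of first derivatives of `φ` cancel,
except those which combine to the squared length `dφ (η.inverse (dφ))` of the gradient. -/
theorem curvatureEnd_localConformal (hs : ∀ v w, η v w = η w v)
    (hn : ∀ v, (∀ w, η v w = 0) → v = 0) (hφ : ContDiff ℝ ∞ φ) (hφ0 : ∀ x, φ x ≠ 0)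
    (y u v w : E) :
    curvatureEnd (localConformal η φ) y v w u =
      ((φ y)⁻¹ * fderiv ℝ (fderiv ℝ φ) y v w
        - (φ y ^ 2)⁻¹ * fderiv ℝ φ y (η.inverse (fderiv ℝ φ y)) * η v w) • u
      - ((φ y)⁻¹ * fderiv ℝ (fderiv ℝ φ) y u w
        - (φ y ^ 2)⁻¹ * fderiv ℝ φ y (η.inverse (fderiv ℝ φ y)) * η u w) • v
      + ((φ y)⁻¹ * η v w) • η.inverse (fderiv ℝ (fderiv ℝ φ) y u)
      - ((φ y)⁻¹ * η u w) • η.inverse (fderiv ℝ (fderiv ℝ φ) y v) := by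
  have h2 : fderiv ℝ (fderiv ℝ φ) y u v = fderiv ℝ (fderiv ℝ φ) y v u :=
    hφ.contDiffAt.isSymmSndFDerivAt
      (by rw [minSmoothness_of_isRCLikeNormedField]; exact WithTop.coe_le_coe.2 le_top) u v
  have h0 := hφ0 y
  have hA : ∀ a, η a (η.inverse (fderiv ℝ φ y)) = fderiv ℝ φ y a := fun a => by
    rw [hs, apply_inverse_of_nondegenerate hn]
  rw [(isLocalMetricOn_localConformal hs hn hφ hφ0).curvatureEnd_apply (Set.mem_univ y),
    fderiv_christoffel_localConformal hs hn hφ hφ0, fderiv_christoffel_localConformal hs hn hφ hφ0]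
  simp only [christoffel_localConformal hs hn hφ hφ0, map_add, map_sub, map_smul, smul_eq_mul, hA, h2,
    hs v u]
  match_scalars <;> field_simp <;> ring

/-- The Ricci tensor of a conformally flat metric. -/
theorem localRicci_localConformal (hs : ∀ v w, η v w = η w v)
    (hn : ∀ v, (∀ w, η v w = 0) → v = 0) (hφ : ContDiff ℝ ∞ φ) (hφ0 : ∀ x, φ x ≠ 0)
    (y v w : E) :
    localRicci (localConformal η φ) y v w =
      (Module.finrank ℝ E - 2) * (φ y)⁻¹ * fderiv ℝ (fderiv ℝ φ) y v w
      + ((φ y)⁻¹ * formTrace η (fderiv ℝ (fderiv ℝ φ) y)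
        - (Module.finrank ℝ E - 1) * (φ y ^ 2)⁻¹ * fderiv ℝ φ y (η.inverse (fderiv ℝ φ y)))
          * η v w := by
  have h : curvatureEnd (localConformal η φ) y v w =
      ((φ y)⁻¹ * fderiv ℝ (fderiv ℝ φ) y v w
        - (φ y ^ 2)⁻¹ * fderiv ℝ φ y (η.inverse (fderiv ℝ φ y)) * η v w) • LinearMap.id
      - (((φ y)⁻¹ • (fderiv ℝ (fderiv ℝ φ) y).flip w
        - ((φ y ^ 2)⁻¹ * fderiv ℝ φ y (η.inverse (fderiv ℝ φ y))) • η.flip w : E →L[ℝ] ℝ)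
          : E →ₗ[ℝ] ℝ).smulRight v
      + ((φ y)⁻¹ * η v w) • (η.inverse.comp (fderiv ℝ (fderiv ℝ φ) y)).toLinearMap
      - (((φ y)⁻¹ • η.flip w : E →L[ℝ] ℝ) : E →ₗ[ℝ] ℝ).smulRight
          (η.inverse (fderiv ℝ (fderiv ℝ φ) y v)) := by
    refine LinearMap.ext fun u =>
      (curvatureEnd_localConformal hs hn hφ hφ0 y u v w).trans ?_
    simp
  rw [localRicci, h]
  simp only [map_sub, map_add, map_smul, LinearMap.trace_id, LinearMap.trace_smulRight,
    smul_eq_mul, formTrace, ContinuousLinearMap.coe_coe, ContinuousLinearMap.flip_apply, sub_apply,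
    smul_apply, apply_inverse_of_nondegenerate hn]
  ring

theorem localHessian_localConformal (hs : ∀ v w, η v w = η w v)
    (hn : ∀ v, (∀ w, η v w = 0) → v = 0) (hφ : ContDiff ℝ ∞ φ) (hφ0 : ∀ x, φ x ≠ 0)
    (k : E → ℝ) (y v w : E) :
    localHessian (localConformal η φ) k y v w = fderiv ℝ (fderiv ℝ k) y v w
      + (φ y)⁻¹ * (fderiv ℝ φ y v * fderiv ℝ k y w + fderiv ℝ φ y w * fderiv ℝ k y v
        - η v w * fderiv ℝ k y (η.inverse (fderiv ℝ φ y))) := by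
  rw [localHessian, christoffel_localConformal hs hn hφ hφ0]
  simp
  ring

theorem localGradient_localConformal (hs : ∀ v w, η v w = η w v)
    (hn : ∀ v, (∀ w, η v w = 0) → v = 0) (hφ : ContDiff ℝ ∞ φ) (hφ0 : ∀ x, φ x ≠ 0)
    (k : E → ℝ) (y : E) :
    localGradient (localConformal η φ) k y = φ y ^ 2 • η.inverse (fderiv ℝ k y) := by
  refine (isLocalMetricOn_localConformal hs hn hφ hφ0).localGradient_eq (Set.mem_univ y)
    fun w => ?_
  have h0 := hφ0 y
  rw [localConformal_apply, map_smul, smul_apply, apply_inverse_of_nondegenerate hn, smul_eq_mul]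
  field_simp

/-- The Laplacian of a conformally flat metric. -/
theorem localLaplacian_localConformal (hs : ∀ v w, η v w = η w v)
    (hn : ∀ v, (∀ w, η v w = 0) → v = 0) (hφ : ContDiff ℝ ∞ φ) (hφ0 : ∀ x, φ x ≠ 0)
    {k : E → ℝ} (hk : ContDiff ℝ ∞ k) (y : E) :
    localLaplacian (localConformal η φ) k y =
      φ y ^ 2 * formTrace η (fderiv ℝ (fderiv ℝ k) y)
      - (Module.finrank ℝ E - 2) * φ y * fderiv ℝ φ y (η.inverse (fderiv ℝ k y)) := by
  have h1 : HasFDerivAt φ (fderiv ℝ φ y) y := (hφ.differentiable (by simp) y).hasFDerivAt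
  have h2 := (differentiableAt_fderiv (y := y) hk.contDiffAt).hasFDerivAt
  have h3 : HasFDerivAt (fun z => η.inverse (fderiv ℝ k z)) _ y :=
    η.inverse.hasFDerivAt.comp y h2
  have h4 := (h1.pow 2).smul h3
  have he : localGradient (localConformal η φ) k = _ :=
    funext fun z => localGradient_localConformal hs hn hφ hφ0 k z
  have h0 := hφ0 y
  have h : localCovariantDeriv (localConformal η φ) (localGradient (localConformal η φ) k) y =
      (φ y • (fderiv ℝ φ y) : E →ₗ[ℝ] ℝ).smulRight (η.inverse (fderiv ℝ k y))
      + φ y ^ 2 • (η.inverse.comp (fderiv ℝ (fderiv ℝ k) y)).toLinearMap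
      - (φ y * fderiv ℝ φ y (η.inverse (fderiv ℝ k y))) • LinearMap.id
      + (φ y • (fderiv ℝ k y) : E →ₗ[ℝ] ℝ).smulRight (η.inverse (fderiv ℝ φ y)) := by
    refine LinearMap.ext fun u => ?_
    have h5 : fderiv ℝ (localGradient (localConformal η φ) k) y u =
        φ y ^ 2 • η.inverse (fderiv ℝ (fderiv ℝ k) y u)
          + (2 * φ y * fderiv ℝ φ y u) • η.inverse (fderiv ℝ k y) := by
      rw [he]
      refine (congrArg (fun A => A u) h4.fderiv).trans ?_
      simp [mul_assoc]
    change fderiv ℝ (localGradient (localConformal η φ) k) y u + christoffel _ y u _ = _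
    rw [h5, localGradient_localConformal hs hn hφ hφ0, christoffel_localConformal hs hn hφ hφ0]
    simp only [map_smul, smul_eq_mul, hs u, apply_inverse_of_nondegenerate hn,
      smul_apply, LinearMap.smulRight_apply, LinearMap.add_apply, LinearMap.sub_apply,
      LinearMap.smul_apply, LinearMap.id_apply, ContinuousLinearMap.coe_coe,
      ContinuousLinearMap.comp_apply]
    match_scalars <;> field_simp
    ring
  rw [localLaplacian, h]
  simp only [map_sub, map_add, map_smul, LinearMap.trace_id, LinearMap.trace_smulRight,
    smul_eq_mul, formTrace, ContinuousLinearMap.coe_coe, LinearMap.smul_apply,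
    apply_inverse_comm hs hn (fderiv ℝ k y)]
  ring

end LocalConformal

/-! ### From the manifold to its charts, and the soliton tensor -/

section Transport

variable {E : Type*} [NormedAddCommGroup E] [NormedSpace ℝ E]
  {H : Type*} [TopologicalSpace H] {I : ModelWithCorners ℝ E H}
  {M : Type*} [TopologicalSpace M] [ChartedSpace H M] [IsManifold I ∞ M] [I.Boundaryless]

theorem isLocalMetricOn_chartForm (g : SemiRiemannianMetric I M) (p : M) :
    IsLocalMetricOn (chartForm g.val p) (extChartAt I p).target where
  isOpen := isOpen_extChartAt_target p
  symm y _ v w := by rw [chartForm_apply, chartForm_apply, g.symm]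
  nondegenerate y hy v hv := by
    have hinv := isInvertible_mfderivWithin_extChartAt_symm (I := I) hy
    rw [ModelWithCorners.Boundaryless.range_eq_univ, mfderivWithin_univ] at hinv
    obtain ⟨e, he⟩ := hinv
    have h1 : mfderiv 𝓘(ℝ, E) I (extChartAt I p).symm y v = 0 := by
      refine g.nondegenerate _ _ fun w => ?_
      have h := (chartForm_apply g.val p y v (e.symm w)).symm.trans (hv (e.symm w))
      rw [← he] at h
      rw [← he]
      exact (congrArg _ (e.apply_symm_apply w)).symm.trans h
    rw [← he] at h1
    exact e.map_eq_zero_iff.1 h1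
  smooth := g.smooth p

/-- At the point `p`, the chart around `p` identifies the metric with its expression in the chart. -/
theorem chartForm_self (g : SemiRiemannianMetric I M) (p : M) (v w : E) :
    chartForm g.val p (extChartAt I p p) v w = g.val p v w := by
  have h := mfderivWithin_range_extChartAt_symm (I := I) (x := p)
  rw [ModelWithCorners.Boundaryless.range_eq_univ, mfderivWithin_univ] at h
  have aux : ∀ q : M, q = p → (g.val q : E →L[ℝ] E →L[ℝ] ℝ) v w = g.val p v w := by
    rintro _ rfl
    rfl
  rw [chartForm_apply, h]
  exact aux _ (extChartAt_to_inv p)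

/-- The Ricci tensor in the chart around the point: the derivative of that chart at the point is the
identity, because it also trivializes the tangent space there. -/
theorem ricci_eq (g : SemiRiemannianMetric I M) (p : M) (v w : TangentSpace I p) :
    g.ricci p v w = localRicci (chartForm g.val p) (extChartAt I p p) v w := by
  rw [SemiRiemannianMetric.ricci, mfderiv_extChartAt_self]
  rfl

theorem hessian_eq (g : SemiRiemannianMetric I M) (k : M → ℝ) (p : M) (v w : TangentSpace I p) :
    g.hessian k p v w =
      localHessian (chartForm g.val p) (k ∘ (extChartAt I p).symm) (extChartAt I p p) v w := by
  rw [SemiRiemannianMetric.hessian, mfderiv_extChartAt_self]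
  rfl

end Transport

section Soliton

variable {n m : ℕ} {ε : Fin n → ℝ}

theorem pseudoEuclideanForm_symm (ε : Fin n → ℝ) (v w : EuclideanSpace ℝ (Fin n)) :
    pseudoEuclideanForm ε v w = pseudoEuclideanForm ε w v := by
  rw [pseudoEuclideanForm_apply, pseudoEuclideanForm_apply]
  exact Finset.sum_congr rfl fun i _ => by ring

theorem pseudoEuclideanForm_nondegenerate (hε : ∀ i, ε i = 1 ∨ ε i = -1)
    (v : EuclideanSpace ℝ (Fin n)) (hv : ∀ w, pseudoEuclideanForm ε v w = 0) : v = 0 :=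
  (SemiRiemannianMetric.pseudoEuclidean ε hε).nondegenerate v v hv

theorem chartForm_conformal_pseudoEuclidean (hε : ∀ i, ε i = 1 ∨ ε i = -1)
    {φ : EuclideanSpace ℝ (Fin n) → ℝ} (hφ : ContDiff ℝ ∞ φ) (hφ0 : ∀ x, φ x ≠ 0)
    (x y : EuclideanSpace ℝ (Fin n)) :
    chartForm ((SemiRiemannianMetric.pseudoEuclidean ε hε).conformal φ hφ.contMDiff hφ0).val x y =
      localConformal (pseudoEuclideanForm ε) φ y := by
  have h : mfderiv (𝓡 n) (𝓡 n) (extChartAt (𝓡 n) x).symm y = ContinuousLinearMap.id ℝ _ := by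
    simp only [mfld_simps]
    exact mfderiv_id
  unfold chartForm
  rw [h]
  rfl

variable {F : Type*} [TopologicalSpace F] [ChartedSpace (EuclideanSpace ℝ (Fin m)) F]
    [IsManifold (𝓡 m) ∞ F]

/-- In the chart around a point, the metric of `(ℝⁿ, φ⁻² η) ×_f F` is the local warped product of
the conformally flat metric and the expression of the metric of `F` in a chart. -/
theorem chartForm_warpedProduct (hε : ∀ i, ε i = 1 ∨ ε i = -1)
    (gF : SemiRiemannianMetric (𝓡 m) F) {f φ : EuclideanSpace ℝ (Fin n) → ℝ}
    (hf : ContDiff ℝ ∞ f) (hφ : ContDiff ℝ ∞ φ) (hf0 : ∀ x, 0 < f x) (hφ0 : ∀ x, φ x ≠ 0)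
    (p : EuclideanSpace ℝ (Fin n) × F) :
    chartForm (warpedProduct ((SemiRiemannianMetric.pseudoEuclidean ε hε).conformal φ
        hφ.contMDiff hφ0) gF f hf.contMDiff hf0).val p
      =ᶠ[nhds (extChartAt ((𝓡 n).prod (𝓡 m)) p p)]
        localWarped (localConformal (pseudoEuclideanForm ε) φ) (chartForm gF.val p.2) f := by
  filter_upwards [extChartAt_target_mem_nhds (I := (𝓡 n).prod (𝓡 m)) p] with y hy
  refine (chartForm_warpedForm _ gF f p y hy).trans ?_
  rw [chartForm_conformal_pseudoEuclidean hε hφ hφ0]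
  rfl

/-- The component of `Ric + Hess h - ρ g` along the base, for the warped product
`(ℝⁿ, φ⁻² η) ×_f F` with an `m`-dimensional fiber. -/
def solitonBase (η : EuclideanSpace ℝ (Fin n) →L[ℝ] EuclideanSpace ℝ (Fin n) →L[ℝ] ℝ) (m : ℕ)
    (f φ h : EuclideanSpace ℝ (Fin n) → ℝ) (ρ : ℝ) (x : EuclideanSpace ℝ (Fin n)) :
    EuclideanSpace ℝ (Fin n) →L[ℝ] EuclideanSpace ℝ (Fin n) →L[ℝ] ℝ :=
  (((n : ℝ) - 2) * (φ x)⁻¹) • fderiv ℝ (fderiv ℝ φ) x + fderiv ℝ (fderiv ℝ h) x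
    - (m * (f x)⁻¹) • fderiv ℝ (fderiv ℝ f) x
    + (φ x)⁻¹ • ((fderiv ℝ φ x).smulRight (fderiv ℝ h x) + (fderiv ℝ h x).smulRight (fderiv ℝ φ x))
    - (m * (f x)⁻¹ * (φ x)⁻¹) •
      ((fderiv ℝ φ x).smulRight (fderiv ℝ f x) + (fderiv ℝ f x).smulRight (fderiv ℝ φ x))
    + ((φ x)⁻¹ * formTrace η (fderiv ℝ (fderiv ℝ φ) x)
        - ((n : ℝ) - 1) * (φ x ^ 2)⁻¹ * fderiv ℝ φ x (η.inverse (fderiv ℝ φ x))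
        - (φ x)⁻¹ * fderiv ℝ φ x (η.inverse (fderiv ℝ h x))
        + m * (f x)⁻¹ * (φ x)⁻¹ * fderiv ℝ φ x (η.inverse (fderiv ℝ f x))
        - ρ * (φ x ^ 2)⁻¹) • η

/-- The coefficient of the fiber metric in `Ric + Hess h - ρ g`, for the warped product
`(ℝⁿ, φ⁻² η) ×_f F` whose fiber is `m`-dimensional and Einstein with constant `lam`. -/
def solitonFiber (η : EuclideanSpace ℝ (Fin n) →L[ℝ] EuclideanSpace ℝ (Fin n) →L[ℝ] ℝ) (m : ℕ)
    (f φ h : EuclideanSpace ℝ (Fin n) → ℝ) (ρ lam : ℝ) (x : EuclideanSpace ℝ (Fin n)) : ℝ :=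
  lam - f x * (φ x ^ 2 * formTrace η (fderiv ℝ (fderiv ℝ f) x)
      - ((n : ℝ) - 2) * φ x * fderiv ℝ φ x (η.inverse (fderiv ℝ f x)))
    - ((m : ℝ) - 1) * φ x ^ 2 * fderiv ℝ f x (η.inverse (fderiv ℝ f x))
    + f x * φ x ^ 2 * fderiv ℝ h x (η.inverse (fderiv ℝ f x)) - ρ * f x ^ 2

/-- The soliton tensor `Ric + Hess h - ρ g` of the warped product splits into a tensor on the base
and a multiple of the fiber metric. -/
theorem ricci_add_hessian_sub_warpedProduct (hε : ∀ i, ε i = 1 ∨ ε i = -1)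
    (gF : SemiRiemannianMetric (𝓡 m) F) {lamF : ℝ} (hF : gF.IsEinstein lamF)
    {f φ h : EuclideanSpace ℝ (Fin n) → ℝ}
    (hf : ContDiff ℝ ∞ f) (hφ : ContDiff ℝ ∞ φ) (hh : ContDiff ℝ ∞ h)
    (hf0 : ∀ x, 0 < f x) (hφ0 : ∀ x, φ x ≠ 0) (ρ : ℝ)
    {g : SemiRiemannianMetric ((𝓡 n).prod (𝓡 m)) (EuclideanSpace ℝ (Fin n) × F)}
    (hg : g = warpedProduct ((SemiRiemannianMetric.pseudoEuclidean ε hε).conformal φ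
        hφ.contMDiff hφ0) gF f hf.contMDiff hf0)
    (p : EuclideanSpace ℝ (Fin n) × F)
    (v w : EuclideanSpace ℝ (Fin n) × EuclideanSpace ℝ (Fin m)) :
    g.ricci p v w + g.hessian (fun p => h p.1) p v w - ρ * g.val p v w =
      solitonBase (pseudoEuclideanForm ε) m f φ h ρ p.1 v.1 w.1
        + solitonFiber (pseudoEuclideanForm ε) m f φ h ρ lamF p.1 * gF.val p.2 v.2 w.2 := by
  have hs := pseudoEuclideanForm_symm ε
  have hn := pseudoEuclideanForm_nondegenerate hε
  have hB := isLocalMetricOn_localConformal hs hn hφ hφ0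
  have hK := isLocalMetricOn_chartForm gF p.2
  have hc := chartForm_warpedProduct hε gF hf hφ hf0 hφ0 p
  have hf0' : ∀ x ∈ Set.univ, f x ≠ 0 := fun x _ => (hf0 x).ne'
  have hy : (p.1, extChartAt (𝓡 m) p.2 p.2) ∈ Set.univ ×ˢ (extChartAt (𝓡 m) p.2).target :=
    ⟨Set.mem_univ _, mem_extChartAt_target p.2⟩
  have hp : extChartAt ((𝓡 n).prod (𝓡 m)) p p = (p.1, extChartAt (𝓡 m) p.2 p.2) := by
    rw [extChartAt_prod]
    rfl
  have hE : localRicci (chartForm gF.val p.2) (extChartAt (𝓡 m) p.2 p.2) v.2 w.2 =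
      lamF * gF.val p.2 v.2 w.2 := (ricci_eq gF p.2 v.2 w.2).symm.trans (hF p.2 v.2 w.2)
  have hval : g.val p v w = (φ p.1 ^ 2)⁻¹ * pseudoEuclideanForm ε v.1 w.1
      + f p.1 ^ 2 * gF.val p.2 v.2 w.2 := by
    rw [hg]
    exact warpedForm_apply _ gF f p v w
  have hk : (fun p : EuclideanSpace ℝ (Fin n) × F => h p.1) ∘
      (extChartAt ((𝓡 n).prod (𝓡 m)) p).symm = fun z => h z.1 := by
    rw [extChartAt_prod]
    rfl
  have h1 := ricci_eq g p v w
  have h2 := hessian_eq g (fun p => h p.1) p v w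
  rw [← hg] at hc
  rw [localRicci_congr hc, hp, localRicci_localWarped hB hK hf.contDiffOn hf0' hy,
    localRicci_localConformal hs hn hφ hφ0, localHessian_localConformal hs hn hφ hφ0,
    localLaplacian_localConformal hs hn hφ hφ0 hf, localGradient_localConformal hs hn hφ hφ0, hE,
    chartForm_self] at h1
  rw [localHessian_congr hc, hp, hk, localHessian_localWarped hB hK hf.contDiffOn hf0'
    hh.contDiffOn hy, localHessian_localConformal hs hn hφ hφ0,
    localGradient_localConformal hs hn hφ hφ0, chartForm_self] at h2
  rw [h1, h2, hval, solitonFiber, solitonBase]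
  simp only [add_apply, sub_apply, smul_apply, ContinuousLinearMap.smulRight_apply, smul_eq_mul,
    finrank_euclideanSpace_fin, map_smul, apply_inverse_comm hs hn (fderiv ℝ h p.1) (fderiv ℝ φ p.1),
    apply_inverse_comm hs hn (fderiv ℝ f p.1) (fderiv ℝ φ p.1)]
  have := hφ0 p.1
  have := (hf0 p.1).ne'
  field_simp
  ring

end Soliton

/-! ### Coordinate expressions -/

section Coordinates

variable {n : ℕ} {ε : Fin n → ℝ}

theorem pseudoEuclideanForm_single (i j : Fin n) :
    pseudoEuclideanForm ε (EuclideanSpace.single i 1) (EuclideanSpace.single j 1) =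
      if i = j then ε i else 0 := by
  rw [pseudoEuclideanForm_apply]
  rcases eq_or_ne i j with rfl | h
  · simp
  · simp [h, h.symm]

theorem inverse_pseudoEuclideanForm_apply (hε : ∀ i, ε i = 1 ∨ ε i = -1)
    (β : EuclideanSpace ℝ (Fin n) →L[ℝ] ℝ) (k : Fin n) :
    (pseudoEuclideanForm ε).inverse β k = ε k * β (EuclideanSpace.single k 1) := by
  rw [← apply_inverse_of_nondegenerate (pseudoEuclideanForm_nondegenerate hε) β,
    pseudoEuclideanForm_apply]
  have h : ε k * ε k = 1 := by rcases hε k with h | h <;> rw [h] <;> norm_num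
  simp [← mul_assoc, h]

theorem apply_inverse_pseudoEuclideanForm (hε : ∀ i, ε i = 1 ∨ ε i = -1)
    (β γ : EuclideanSpace ℝ (Fin n) →L[ℝ] ℝ) :
    γ ((pseudoEuclideanForm ε).inverse β) =
      ∑ k, ε k * (γ (EuclideanSpace.single k 1) * β (EuclideanSpace.single k 1)) := by
  rw [← apply_inverse_of_nondegenerate (pseudoEuclideanForm_nondegenerate hε) γ,
    pseudoEuclideanForm_apply]
  refine Finset.sum_congr rfl fun k _ => ?_
  have h : ε k * ε k = 1 := by rcases hε k with h | h <;> rw [h] <;> norm_num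
  rw [inverse_pseudoEuclideanForm_apply hε, inverse_pseudoEuclideanForm_apply hε]
  linear_combination ε k * γ (EuclideanSpace.single k 1) * β (EuclideanSpace.single k 1) * h

theorem formTrace_pseudoEuclideanForm (hε : ∀ i, ε i = 1 ∨ ε i = -1)
    (b : EuclideanSpace ℝ (Fin n) →L[ℝ] EuclideanSpace ℝ (Fin n) →L[ℝ] ℝ) :
    formTrace (pseudoEuclideanForm ε) b =
      ∑ k, ε k * b (EuclideanSpace.single k 1) (EuclideanSpace.single k 1) := by
  rw [formTrace, LinearMap.trace_eq_matrix_trace ℝ (EuclideanSpace.basisFun (Fin n) ℝ).toBasis,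
    Matrix.trace]
  refine Finset.sum_congr rfl fun k _ => ?_
  simp [LinearMap.toMatrix_apply, inverse_pseudoEuclideanForm_apply hε]

theorem partialDeriv_partialDeriv {u : EuclideanSpace ℝ (Fin n) → ℝ} (hu : ContDiff ℝ ∞ u)
    (i j : Fin n) (x : EuclideanSpace ℝ (Fin n)) :
    partialDeriv j (partialDeriv i u) x =
      fderiv ℝ (fderiv ℝ u) x (EuclideanSpace.single j 1) (EuclideanSpace.single i 1) := by
  have h := (differentiableAt_fderiv (y := x) hu.contDiffAt).hasFDerivAt.clm_apply
    (hasFDerivAt_const (EuclideanSpace.single i (1 : ℝ)) x)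
  refine (congrArg (fun A => A (EuclideanSpace.single j 1)) h.fderiv).trans ?_
  simp

/-- A bilinear form on `ℝⁿ` vanishes if and only if its matrix does. -/
theorem eq_zero_iff_forall_single
    (b : EuclideanSpace ℝ (Fin n) →L[ℝ] EuclideanSpace ℝ (Fin n) →L[ℝ] ℝ) :
    b = 0 ↔ ∀ i j, b (EuclideanSpace.single j 1) (EuclideanSpace.single i 1) = 0 := by
  refine ⟨fun h i j => by simp [h], fun h => ?_⟩
  refine ContinuousLinearMap.coe_injective
    ((EuclideanSpace.basisFun (Fin n) ℝ).toBasis.ext fun j => ?_)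
  refine ContinuousLinearMap.coe_injective
    ((EuclideanSpace.basisFun (Fin n) ℝ).toBasis.ext fun i => ?_)
  simpa using h i j

end Coordinates

/-! ### The soliton equations -/

section Equations

variable {n m : ℕ} {ε : Fin n → ℝ} {f φ h : EuclideanSpace ℝ (Fin n) → ℝ}

/-- The soliton equation decouples: testing it on vectors tangent to the base and to the fiber gives
one tensor equation on the base and one scalar equation. -/
theorem isGradientRicciSoliton_iff (hm : 1 ≤ m) (hε : ∀ i, ε i = 1 ∨ ε i = -1)
    {F : Type*} [TopologicalSpace F] [ChartedSpace (EuclideanSpace ℝ (Fin m)) F]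
    [IsManifold (𝓡 m) ∞ F] [Nonempty F]
    (gF : SemiRiemannianMetric (𝓡 m) F) {lamF : ℝ} (hF : gF.IsEinstein lamF)
    (hf : ContDiff ℝ ∞ f) (hφ : ContDiff ℝ ∞ φ) (hh : ContDiff ℝ ∞ h)
    (hf0 : ∀ x, 0 < f x) (hφ0 : ∀ x, φ x ≠ 0) (ρ : ℝ) :
    (warpedProduct ((SemiRiemannianMetric.pseudoEuclidean ε hε).conformal φ hφ.contMDiff hφ0)
        gF f hf.contMDiff hf0).IsGradientRicciSoliton (fun p => h p.1) ρ ↔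
      ∀ x, solitonBase (pseudoEuclideanForm ε) m f φ h ρ x = 0 ∧
        solitonFiber (pseudoEuclideanForm ε) m f φ h ρ lamF x = 0 := by
  have key := ricci_add_hessian_sub_warpedProduct hε gF hF hf hφ hh hf0 hφ0 ρ rfl
  constructor
  · intro hsol x
    obtain ⟨q⟩ := ‹Nonempty F›
    have h0 : ∀ v w : EuclideanSpace ℝ (Fin n) × EuclideanSpace ℝ (Fin m),
        solitonBase (pseudoEuclideanForm ε) m f φ h ρ x v.1 w.1
          + solitonFiber (pseudoEuclideanForm ε) m f φ h ρ lamF x * gF.val q v.2 w.2 = 0 :=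
      fun v w => (key (x, q) v w).symm.trans (sub_eq_zero.2 (hsol.equation (x, q) v w))
    refine ⟨?_, ?_⟩
    · ext v w
      have h1 : gF.val q (0 : EuclideanSpace ℝ (Fin m)) (0 : EuclideanSpace ℝ (Fin m)) = 0 :=
        map_zero _
      have h2 := h0 (v, 0) (w, 0)
      rw [h1, mul_zero, add_zero] at h2
      exact h2
    · -- The fiber metric does not vanish, because the fiber has positive dimension.
      have : NeZero m := ⟨by omega⟩
      by_contra hc
      have h1 : (EuclideanSpace.single (0 : Fin m) (1 : ℝ)) = 0 := by
        refine gF.nondegenerate q _ fun w => ?_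
        have h2 := h0 (0, EuclideanSpace.single (0 : Fin m) (1 : ℝ)) (0, w)
        rw [map_zero, zero_add] at h2
        exact (mul_eq_zero.1 h2).resolve_left hc
      simpa using congrArg norm h1
  · intro hx
    refine ⟨hh.contMDiff.comp contMDiff_fst, fun p v w => sub_eq_zero.1 ?_⟩
    refine (key p v w).trans ?_
    rw [(hx p.1).1, (hx p.1).2]
    simp

/-- The matrix of the base component of the soliton tensor, after clearing denominators. -/
theorem solitonBase_apply_single (hε : ∀ i, ε i = 1 ∨ ε i = -1)
    (hf : ContDiff ℝ ∞ f) (hφ : ContDiff ℝ ∞ φ) (hh : ContDiff ℝ ∞ h)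
    (hf0 : ∀ x, 0 < f x) (hφ0 : ∀ x, φ x ≠ 0) (ρ : ℝ) (x : EuclideanSpace ℝ (Fin n))
    (i j : Fin n) :
    f x * φ x ^ 2 * solitonBase (pseudoEuclideanForm ε) m f φ h ρ x
        (EuclideanSpace.single j 1) (EuclideanSpace.single i 1) =
      φ x * (((n : ℝ) - 2) * f x * partialDeriv j (partialDeriv i φ) x
          + f x * φ x * partialDeriv j (partialDeriv i h) x
          - m * φ x * partialDeriv j (partialDeriv i f) x
          - m * partialDeriv i φ x * partialDeriv j f x
          - m * partialDeriv j φ x * partialDeriv i f x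
          + f x * partialDeriv i φ x * partialDeriv j h x
          + f x * partialDeriv j φ x * partialDeriv i h x)
        + (if j = i then ε j else 0) * (∑ k, ε k *
          (f x * φ x * partialDeriv k (partialDeriv k φ) x
            - ((n : ℝ) - 1) * f x * partialDeriv k φ x ^ 2
            + m * φ x * partialDeriv k φ x * partialDeriv k f x
            - f x * φ x * partialDeriv k φ x * partialDeriv k h x) - ρ * f x) := by
  have h1 := hφ0 x
  have h2 := (hf0 x).ne'
  have hsum : ∑ k, ε k *
      (f x * φ x * partialDeriv k (partialDeriv k φ) x
        - ((n : ℝ) - 1) * f x * partialDeriv k φ x ^ 2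
        + m * φ x * partialDeriv k φ x * partialDeriv k f x
        - f x * φ x * partialDeriv k φ x * partialDeriv k h x) =
      f x * φ x * formTrace (pseudoEuclideanForm ε) (fderiv ℝ (fderiv ℝ φ) x)
        - ((n : ℝ) - 1) * f x * fderiv ℝ φ x ((pseudoEuclideanForm ε).inverse (fderiv ℝ φ x))
        + m * φ x * fderiv ℝ φ x ((pseudoEuclideanForm ε).inverse (fderiv ℝ f x))
        - f x * φ x * fderiv ℝ φ x ((pseudoEuclideanForm ε).inverse (fderiv ℝ h x)) := by
    simp only [formTrace_pseudoEuclideanForm hε, apply_inverse_pseudoEuclideanForm hε,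
      Finset.mul_sum, ← Finset.sum_add_distrib, ← Finset.sum_sub_distrib]
    refine Finset.sum_congr rfl fun k _ => ?_
    rw [partialDeriv_partialDeriv hφ]
    simp only [partialDeriv]
    ring
  rw [hsum, solitonBase, partialDeriv_partialDeriv hφ, partialDeriv_partialDeriv hf,
    partialDeriv_partialDeriv hh]
  simp only [add_apply, sub_apply, smul_apply, ContinuousLinearMap.smulRight_apply, smul_eq_mul,
    pseudoEuclideanForm_single, partialDeriv]
  field_simp
  ring

/-- The fiber component of the soliton tensor in coordinates. -/
theorem solitonFiber_eq (hε : ∀ i, ε i = 1 ∨ ε i = -1) (hf : ContDiff ℝ ∞ f) (ρ lam : ℝ)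
    (x : EuclideanSpace ℝ (Fin n)) :
    solitonFiber (pseudoEuclideanForm ε) m f φ h ρ lam x =
      ∑ k, ε k *
          (-(f x * φ x ^ 2 * partialDeriv k (partialDeriv k f) x)
            + ((n : ℝ) - 2) * f x * φ x * partialDeriv k f x * partialDeriv k φ x
            - ((m : ℝ) - 1) * φ x ^ 2 * partialDeriv k f x ^ 2
            + f x * φ x ^ 2 * partialDeriv k f x * partialDeriv k h x)
        - (ρ * f x ^ 2 - lam) := by
  have hsum : ∑ k, ε k *
      (-(f x * φ x ^ 2 * partialDeriv k (partialDeriv k f) x)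
        + ((n : ℝ) - 2) * f x * φ x * partialDeriv k f x * partialDeriv k φ x
        - ((m : ℝ) - 1) * φ x ^ 2 * partialDeriv k f x ^ 2
        + f x * φ x ^ 2 * partialDeriv k f x * partialDeriv k h x) =
      -(f x * φ x ^ 2) * formTrace (pseudoEuclideanForm ε) (fderiv ℝ (fderiv ℝ f) x)
        + ((n : ℝ) - 2) * f x * φ x
          * fderiv ℝ φ x ((pseudoEuclideanForm ε).inverse (fderiv ℝ f x))
        - ((m : ℝ) - 1) * φ x ^ 2 * fderiv ℝ f x ((pseudoEuclideanForm ε).inverse (fderiv ℝ f x))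
        + f x * φ x ^ 2 * fderiv ℝ h x ((pseudoEuclideanForm ε).inverse (fderiv ℝ f x)) := by
    simp only [formTrace_pseudoEuclideanForm hε, apply_inverse_pseudoEuclideanForm hε,
      Finset.mul_sum, ← Finset.sum_add_distrib, ← Finset.sum_sub_distrib]
    refine Finset.sum_congr rfl fun k _ => ?_
    rw [partialDeriv_partialDeriv hf]
    simp only [partialDeriv]
    ring
  rw [hsum, solitonFiber]
  ring

end Equations

end SemiRiem

end

theorem theorem1p2 {n m : ℕ} (hn : 3 ≤ n) (hm : 1 ≤ m)
    (ε : Fin n → ℝ) (hε : ∀ i, ε i = 1 ∨ ε i = -1)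
    {F : Type*} [TopologicalSpace F] [ChartedSpace (EuclideanSpace ℝ (Fin m)) F]
    [IsManifold (𝓡 m) ∞ F] [Nonempty F]
    (gF : SemiRiemannianMetric (𝓡 m) F) (lamF : ℝ) (hF : gF.IsEinstein lamF)
    (f φ h : EuclideanSpace ℝ (Fin n) → ℝ)
    (hf : ContDiff ℝ ∞ f) (hφ : ContDiff ℝ ∞ φ) (hh : ContDiff ℝ ∞ h)
    (hf0 : ∀ x, 0 < f x) (hφ0 : ∀ x, φ x ≠ 0) (ρ : ℝ) :
    (warpedProduct
        ((SemiRiemannianMetric.pseudoEuclidean ε hε).conformal φ hφ.contMDiff hφ0)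
        gF f hf.contMDiff hf0).IsGradientRicciSoliton (fun p => h p.1) ρ ↔
      (∀ (x : EuclideanSpace ℝ (Fin n)) (i j : Fin n), i ≠ j →
        ((n : ℝ) - 2) * f x * partialDeriv j (partialDeriv i φ) x
          + f x * φ x * partialDeriv j (partialDeriv i h) x
          - m * φ x * partialDeriv j (partialDeriv i f) x
          - m * partialDeriv i φ x * partialDeriv j f x
          - m * partialDeriv j φ x * partialDeriv i f x
          + f x * partialDeriv i φ x * partialDeriv j h x
          + f x * partialDeriv j φ x * partialDeriv i h x = 0) ∧
      (∀ (x : EuclideanSpace ℝ (Fin n)) (i : Fin n),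
        φ x * (((n : ℝ) - 2) * f x * partialDeriv i (partialDeriv i φ) x
          + f x * φ x * partialDeriv i (partialDeriv i h) x
          - m * φ x * partialDeriv i (partialDeriv i f) x
          - 2 * m * partialDeriv i φ x * partialDeriv i f x
          + 2 * f x * partialDeriv i φ x * partialDeriv i h x)
        + ε i * ∑ k, ε k *
          (f x * φ x * partialDeriv k (partialDeriv k φ) x
            - ((n : ℝ) - 1) * f x * partialDeriv k φ x ^ 2
            + m * φ x * partialDeriv k φ x * partialDeriv k f x
            - f x * φ x * partialDeriv k φ x * partialDeriv k h x)
          = ε i * ρ * f x) ∧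
      (∀ x : EuclideanSpace ℝ (Fin n),
        ∑ k, ε k *
          (-(f x * φ x ^ 2 * partialDeriv k (partialDeriv k f) x)
            + ((n : ℝ) - 2) * f x * φ x * partialDeriv k f x * partialDeriv k φ x
            - ((m : ℝ) - 1) * φ x ^ 2 * partialDeriv k f x ^ 2
            + f x * φ x ^ 2 * partialDeriv k f x * partialDeriv k h x)
          = ρ * f x ^ 2 - lamF) := by
  -- An entry of the base tensor vanishes if and only if its product with `f φ²` does.
  have base : ∀ x i j, solitonBase (pseudoEuclideanForm ε) m f φ h ρ x
      (EuclideanSpace.single j 1) (EuclideanSpace.single i 1) = 0 ↔ _ := fun x i j => by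
    rw [← mul_right_inj' (mul_ne_zero (hf0 x).ne' (pow_ne_zero 2 (hφ0 x))), mul_zero,
      solitonBase_apply_single hε hf hφ hh hf0 hφ0 ρ x i j]
  rw [isGradientRicciSoliton_iff hm hε gF hF hf hφ hh hf0 hφ0]
  simp only [forall_and, eq_zero_iff_forall_single, base]
  refine ⟨fun H => ⟨fun x i j hij => ?_, fun x i => ?_, fun x => ?_⟩, fun H =>
    ⟨fun x i j => ?_, fun x => ?_⟩⟩
  · have := H.1 x i j
    rw [if_neg hij.symm, zero_mul, add_zero] at this
    exact (mul_eq_zero.1 this).resolve_left (hφ0 x)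
  · have := H.1 x i i
    rw [if_pos rfl] at this
    linear_combination this
  · exact sub_eq_zero.1 ((solitonFiber_eq hε hf ρ lamF x).symm.trans (H.2 x))
  · rcases eq_or_ne i j with rfl | hij
    · rw [if_pos rfl]
      linear_combination H.2.1 x i
    · rw [if_neg hij.symm, H.1 x i j hij, mul_zero, zero_mul, add_zero]
  · exact (solitonFiber_eq hε hf ρ lamF x).trans (sub_eq_zero.2 (H.2.2 x))
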